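/- Let $k$ be a field, $N\ge 0$ an integer and $q\in k$ with $q\neq 0$, $q^2\neq 1$, $q^2\ne -1$; put $\lambda=q-q^{-1}$. Let $R$ be the Drinfeld--Jimbo matrix of $GL_q(N)$, $$R^{i_1i_2}_{j_1j_2}=\delta^{i_1}_{j_1}\delta^{i_2}_{j_2}\bigl(1+(q-1)\delta^{i_1i_2}\bigr)+(q-q^{-1})\,\delta^{i_1}_{j_2}\delta^{i_2}_{j_1}\Theta_{i_1i_2},\qquad \Theta_{ij}=1 \text{ if } i>j,\ \Theta_{ij}=0 \text{ if } i\le j,$$ (upper indices label rows, lower indices label columns), let $P$ be the permutation matrix and $\hat R=PR$. For an $N\times N$ matrix $X$ over an algebra let $X_2=1\otimes X$, and let $\mathrm{Tr}_q(X)=\mathrm{Tr}(D^{-1}X)$ with $(D^{-1})^i_j=q^{2(N-i)+1}\delta^i_j$. Let $\mathcal D$ be the associative unital $k$-algebra generated by the entries of $N\times N$ matrices $\omega$, $J$, $L$, subject to $$\omega_2\hat R^{-1}\omega_2\hat R=-\hat R^{-1}\omega_2\hat R^{-1}\omega_2,\qquad \omega_2\hat RL_2\hat R=\hat RL_2\hat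 R\,\omega_2,\qquad \omega_2\hat RJ_2\hat R+\hat RJ_2\hat R\,\omega_2=-\hat R,$$ $$L_2\hat RL_2\hat R=\hat RL_2\hat RL_2,\qquad J_2\hat RL_2\hat R=\hat RL_2\hat RJ_2,\qquad J_2\hat RJ_2\hat R=-\hat R^{-1}J_2\hat RJ_2,$$ together with the entries of two-sided inverses of the matrices $L$ and $W:=1+\lambda\,\omega J$. (Hence every identity below holds in every $k$-algebra that contains matrices $\omega,J,L$ with these relations and with $L$ and $W$ invertible.) Put $\overline W=1+\lambda J\omega$ and $$Q=\mathrm{Tr}_q\Bigl(\tfrac1\lambda\,\omega(L-1)-\omega L(\omega J)(1+\lambda\omega J)^{-1}\Bigr),\qquad Q^*=\mathrm{Tr}_q\Bigl(\tfrac1\lambda\,J(L^{-1}-1)+JL^{-1}J\omega\Bigr),$$ $$\Delta=QQ^*+Q^*Q,\qquad \Theta^*=JL^{-1}\overline W,\qquad U=WL^{-1}\overline W .$$ Then the following hold in $\mathcal D$. 1. $\displaystyle \Delta=\lambda^{-2}\,\mathrm{Tr}_q\bigl(L-2+L^{-1}\overline W-\lambda JL^{-1}\overline W\omega\bigr)$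 and $\displaystyle \Delta=\lambda^{-2}\,\mathrm{Tr}_q\bigl(L+q^{2N}U-2\bigr)$. 2. $[Q,\Delta]=0$ and $[Q^*,\Delta]=0$. 3. $U^i_j=-q^{-2N}\bigl(\mathrm{Tr}_q(\Theta^*)\,\omega^i_j+\omega^i_j\,\mathrm{Tr}_q(\Theta^*)\bigr)$ for all $i,j$, and $U$ satisfies the reflection equation $$\hat R^{-1}U_2\hat R^{-1}U_2=U_2\hat R^{-1}U_2\hat R^{-1}.$$ 4. $\hat RU_2\hat R^{-1}\omega_2=\omega_2\hat R^{-1}U_2\hat R$ and $\hat R^{-1}U_2\hat RJ_2=J_2\hat RU_2\hat R^{-1}$. -/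

import Mathlib

open scoped Kronecker

noncomputable section

namespace QuantumGL

variable {k : Type*} [Field k]

/-- `λ = q - q⁻¹`. -/
def lam (q : k) : k := q - q⁻¹

/-- The Drinfeld-Jimbo matrix of `GL_q(N)`. The row index is the pair of upper indices
`(i₁, i₂)`, the column index is the pair of lower indices `(j₁, j₂)`:
`R^{i₁ i₂}_{j₁ j₂} = δ^{i₁}_{j₁} δ^{i₂}_{j₂} (1 + (q - 1) δ^{i₁ i₂})
  + (q - q⁻¹) δ^{i₁}_{j₂} δ^{i₂}_{j₁} Θ_{i₁ i₂}`, with `Θ_{ij} = 1` if `i > j`, else `0`. -/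
def RMat (q : k) (N : ℕ) : Matrix (Fin N × Fin N) (Fin N × Fin N) k :=
  Matrix.of fun i j =>
    (if i.1 = j.1 ∧ i.2 = j.2 then 1 + (q - 1) * (if i.1 = i.2 then 1 else 0) else 0)
      + (q - q⁻¹) * (if i.1 = j.2 ∧ i.2 = j.1 then (if i.2 < i.1 then 1 else 0) else 0)

/-- The permutation matrix `P₁₂` of the two tensor factors. -/
def PMat (k : Type*) [Field k] (N : ℕ) : Matrix (Fin N × Fin N) (Fin N × Fin N) k :=
  Matrix.of fun i j => if i.1 = j.2 ∧ i.2 = j.1 then 1 else 0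

/-- `R̂ = P₁₂ R₁₂`. -/
def RHat (q : k) (N : ℕ) : Matrix (Fin N × Fin N) (Fin N × Fin N) k :=
  PMat k N * RMat q N

/-- The numerical matrix `D⁻¹ = diag(q^{2(N - i) + 1})`, `i = 1, …, N` (here `i = a + 1`
for `a : Fin N`, so the truncated subtraction is exact). -/
def DInv (q : k) (N : ℕ) : Matrix (Fin N) (Fin N) k :=
  Matrix.diagonal fun a => q ^ (2 * (N - (a.val + 1)) + 1)

section Algebra

variable (A : Type*) [Ring A] [Algebra k A]

/-- `R̂` as a matrix with entries in a `k`-algebra. -/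
def RA (q : k) (N : ℕ) : Matrix (Fin N × Fin N) (Fin N × Fin N) A :=
  (RHat q N).map (algebraMap k A)

/-- `R̂⁻¹` as a matrix with entries in a `k`-algebra. -/
def RAInv (q : k) (N : ℕ) : Matrix (Fin N × Fin N) (Fin N × Fin N) A :=
  ((RHat q N)⁻¹).map (algebraMap k A)

variable {A}

/-- `X₂ = 1 ⊗ X`: the matrix `X` acting in the second of two tensor factors. -/
def sp2 {N : ℕ} (X : Matrix (Fin N) (Fin N) A) :
    Matrix (Fin N × Fin N) (Fin N × Fin N) A :=
  (1 : Matrix (Fin N) (Fin N) A) ⊗ₖ X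

/-- The quantum trace `Tr_q(Y) = Tr(D⁻¹ Y)`. -/
def qTr (q : k) {N : ℕ} (Y : Matrix (Fin N) (Fin N) A) : A :=
  Matrix.trace ((DInv q N).map (algebraMap k A) * Y)

end Algebra

/-- Generators: the entries of the matrices `ω`, `J`, `L`, of `L⁻¹`, and of the inverse of
`W = 1 + λ ω J`, which enters the formula for the BRST operator. -/
inductive Gen (N : ℕ) : Type
  | omega (i j : Fin N)
  | J (i j : Fin N)
  | L (i j : Fin N)
  | Linv (i j : Fin N)
  | Winv (i j : Fin N)

section Free

variable (k) (N : ℕ)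

def freeOmega : Matrix (Fin N) (Fin N) (FreeAlgebra k (Gen N)) :=
  Matrix.of fun i j => FreeAlgebra.ι k (Gen.omega i j)

def freeJ : Matrix (Fin N) (Fin N) (FreeAlgebra k (Gen N)) :=
  Matrix.of fun i j => FreeAlgebra.ι k (Gen.J i j)

def freeL : Matrix (Fin N) (Fin N) (FreeAlgebra k (Gen N)) :=
  Matrix.of fun i j => FreeAlgebra.ι k (Gen.L i j)

def freeLinv : Matrix (Fin N) (Fin N) (FreeAlgebra k (Gen N)) :=
  Matrix.of fun i j => FreeAlgebra.ι k (Gen.Linv i j)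

def freeWinv : Matrix (Fin N) (Fin N) (FreeAlgebra k (Gen N)) :=
  Matrix.of fun i j => FreeAlgebra.ι k (Gen.Winv i j)

variable {k}

/-- `R̂` over the free algebra. -/
abbrev freeR (q : k) : Matrix (Fin N × Fin N) (Fin N × Fin N) (FreeAlgebra k (Gen N)) :=
  RA (FreeAlgebra k (Gen N)) q N

/-- `R̂⁻¹` over the free algebra. -/
abbrev freeRInv (q : k) : Matrix (Fin N × Fin N) (Fin N × Fin N) (FreeAlgebra k (Gen N)) :=
  RAInv (FreeAlgebra k (Gen N)) q N

end Free

/-- The defining relations, entry by entry: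
* `ω₂ R̂⁻¹ ω₂ R̂ = - R̂⁻¹ ω₂ R̂⁻¹ ω₂`, `ω₂ R̂ L₂ R̂ = R̂ L₂ R̂ ω₂`,
* `ω₂ R̂ J₂ R̂ + R̂ J₂ R̂ ω₂ = - R̂`, `L₂ R̂ L₂ R̂ = R̂ L₂ R̂ L₂`,
* `J₂ R̂ L₂ R̂ = R̂ L₂ R̂ J₂`, `J₂ R̂ J₂ R̂ = - R̂⁻¹ J₂ R̂ J₂`,
* `Linv` is the two-sided inverse of `L`, and `Winv` that of `1 + λ ω J`. -/
inductive Rel (q : k) (N : ℕ) : FreeAlgebra k (Gen N) → FreeAlgebra k (Gen N) → Prop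
  | omega_omega (a b : Fin N × Fin N) : Rel q N
      ((sp2 (freeOmega k N) * freeRInv N q * sp2 (freeOmega k N) * freeR N q) a b)
      ((-(freeRInv N q * sp2 (freeOmega k N) * freeRInv N q * sp2 (freeOmega k N))) a b)
  | omega_L (a b : Fin N × Fin N) : Rel q N
      ((sp2 (freeOmega k N) * freeR N q * sp2 (freeL k N) * freeR N q) a b)
      ((freeR N q * sp2 (freeL k N) * freeR N q * sp2 (freeOmega k N)) a b)
  | omega_J (a b : Fin N × Fin N) : Rel q N
      ((sp2 (freeOmega k N) * freeR N q * sp2 (freeJ k N) * freeR N q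
        + freeR N q * sp2 (freeJ k N) * freeR N q * sp2 (freeOmega k N)) a b)
      ((-freeR N q) a b)
  | L_L (a b : Fin N × Fin N) : Rel q N
      ((sp2 (freeL k N) * freeR N q * sp2 (freeL k N) * freeR N q) a b)
      ((freeR N q * sp2 (freeL k N) * freeR N q * sp2 (freeL k N)) a b)
  | J_L (a b : Fin N × Fin N) : Rel q N
      ((sp2 (freeJ k N) * freeR N q * sp2 (freeL k N) * freeR N q) a b)
      ((freeR N q * sp2 (freeL k N) * freeR N q * sp2 (freeJ k N)) a b)
  | J_J (a b : Fin N × Fin N) : Rel q N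
      ((sp2 (freeJ k N) * freeR N q * sp2 (freeJ k N) * freeR N q) a b)
      ((-(freeRInv N q * sp2 (freeJ k N) * freeR N q * sp2 (freeJ k N))) a b)
  | L_Linv (i j : Fin N) : Rel q N ((freeL k N * freeLinv k N) i j)
      ((1 : Matrix (Fin N) (Fin N) (FreeAlgebra k (Gen N))) i j)
  | Linv_L (i j : Fin N) : Rel q N ((freeLinv k N * freeL k N) i j)
      ((1 : Matrix (Fin N) (Fin N) (FreeAlgebra k (Gen N))) i j)
  | W_Winv (i j : Fin N) : Rel q N
      (((1 + lam q • (freeOmega k N * freeJ k N)) * freeWinv k N) i j)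
      ((1 : Matrix (Fin N) (Fin N) (FreeAlgebra k (Gen N))) i j)
  | Winv_W (i j : Fin N) : Rel q N
      ((freeWinv k N * (1 + lam q • (freeOmega k N * freeJ k N))) i j)
      ((1 : Matrix (Fin N) (Fin N) (FreeAlgebra k (Gen N))) i j)

/-- The algebra of differential forms `ω`, inner derivations `J` and vector fields `L` over
`U_q(gl(N))`, as the associative unital `k`-algebra presented by the relations above. It is
universal among `k`-algebras with matrices `ω`, `J`, `L` that obey these relations and in which
`L` and `1 + λ ω J` are invertible, so an identity that holds here holds in each of them, in
particular after adding the generators `T` of the quantum group. -/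
abbrev DiffAlg (q : k) (N : ℕ) : Type _ := RingQuot (Rel q N)

variable (q : k) (N : ℕ)

/-- The canonical map from the free algebra. -/
def toDiff : FreeAlgebra k (Gen N) →ₐ[k] DiffAlg q N := RingQuot.mkAlgHom k (Rel q N)

/-- The matrix `ω` of left-invariant 1-forms. -/
def omegaM : Matrix (Fin N) (Fin N) (DiffAlg q N) := (freeOmega k N).map (toDiff q N)

/-- The matrix `J` of inner derivations. -/
def JM : Matrix (Fin N) (Fin N) (DiffAlg q N) := (freeJ k N).map (toDiff q N)

/-- The matrix `L` of vector fields. -/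
def LM : Matrix (Fin N) (Fin N) (DiffAlg q N) := (freeL k N).map (toDiff q N)

/-- The matrix `L⁻¹`. -/
def LInvM : Matrix (Fin N) (Fin N) (DiffAlg q N) := (freeLinv k N).map (toDiff q N)

/-- `W = 1 + λ ω J`. -/
def WM : Matrix (Fin N) (Fin N) (DiffAlg q N) := 1 + lam q • (omegaM q N * JM q N)

/-- The matrix `W⁻¹ = (1 + λ ω J)⁻¹`. -/
def WInvM : Matrix (Fin N) (Fin N) (DiffAlg q N) := (freeWinv k N).map (toDiff q N)

/-- `W̄ = 1 + λ J ω`. -/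
def WBarM : Matrix (Fin N) (Fin N) (DiffAlg q N) := 1 + lam q • (JM q N * omegaM q N)

/-- The BRST operator
`Q = Tr_q (ω (L - 1) / λ - ω L (ω J) (1 + λ ω J)⁻¹)`. -/
def brst : DiffAlg q N :=
  qTr q ((lam q)⁻¹ • (omegaM q N * (LM q N - 1))
    - omegaM q N * LM q N * (omegaM q N * JM q N) * WInvM q N)

/-- The anti-BRST operator
`Q* = Tr_q (J (L⁻¹ - 1) / λ + J L⁻¹ J ω)`. -/
def antiBrst : DiffAlg q N :=
  qTr q ((lam q)⁻¹ • (JM q N * (LInvM q N - 1))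
    + JM q N * LInvM q N * JM q N * omegaM q N)

/-- The quantum Laplacian `Δ = Q Q* + Q* Q`. -/
def laplacian : DiffAlg q N := brst q N * antiBrst q N + antiBrst q N * brst q N

/-- `Θ* = J L⁻¹ (1 + λ J ω)`. -/
def ThetaStarM : Matrix (Fin N) (Fin N) (DiffAlg q N) := JM q N * LInvM q N * WBarM q N

/-- The current `U = W L⁻¹ W̄`. -/
def UM : Matrix (Fin N) (Fin N) (DiffAlg q N) := WM q N * LInvM q N * WBarM q N

end QuantumGL

end

open QuantumGL

/-!
Taking the quantum trace over the first tensor factor turns an `R̂`-exchange relation into a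
commutator or anticommutator with a quantum trace, because
`Tr_q⁽¹⁾ (R̂^{±1} X₂ R̂^{∓1}) = Tr_q X`. In particular, if `X₂` commutes with `R̂ L₂ R̂`, then
`Tr_q X` commutes with the entries of `L`.

Put `Θ = ω L W⁻¹`. Then `λ Q = Tr_q (Θ - ω)` and `λ Q* = Tr_q (Θ* - J)`, and the exchange relations
of `ω`, `Θ`, `J`, `Θ*` evaluate the four anticommutators that make up `λ² Δ`. The one of `Tr_q ω`
and `Tr_q Θ*` can be computed from either side, which gives the two formulas for `Δ`. The second,
`λ² Δ = Tr_q (L + q^{2N} U - 2)`, makes the invariance of `Δ` visible: `Tr_q U` commutes with `ω`,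
`J` and `L`, while the four quantum traces in `Q` and `Q*` commute with `L`.
-/

noncomputable section

namespace QuantumGL

section Exchange

variable {k M : Type*} [CommRing k] [Ring M] [Algebra k M]

/-- The relations between the matrices `ω`, `J`, `L` of the differential calculus, as relations
between elements of a ring. In the application this is the ring of `N² × N²` matrices over the
algebra, `R` and `R'` are `R̂` and `R̂⁻¹`, and `ω`, `J`, `L` stand for `ω₂`, `J₂`, `L₂`. -/
structure CartanRelations {M : Type*} [Ring M] (R R' ω J L : M) : Prop where
  omega_omega : ω * R' * ω * R = -(R' * ω * R' * ω)
  omega_L : ω * R * L * R = R * L * R * ω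
  omega_J : ω * R * J * R + R * J * R * ω = -R
  L_L : L * R * L * R = R * L * R * L
  J_L : J * R * L * R = R * L * R * J
  J_J : J * R * J * R = -(R' * J * R * J)

/-- `W = 1 + c ω J`, with `c = λ` in the application. -/
def cartanW (c : k) (ω J : M) : M := 1 + c • (ω * J)

/-- `W̄ = 1 + c J ω`, with `c = λ` in the application. -/
def cartanWBar (c : k) (ω J : M) : M := 1 + c • (J * ω)

/-- `Θ = ω L W⁻¹`. The BRST operator is `Tr_q (Θ - ω) / λ`. -/
def cartanTheta (ω : M) (L W : Mˣ) : M := ω * L * ↑W⁻¹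

/-- `Θ* = J L⁻¹ W̄`. The anti-BRST operator is `Tr_q (Θ* - J) / λ`. -/
def cartanThetaStar (c : k) (ω J : M) (L : Mˣ) : M := J * ↑L⁻¹ * cartanWBar c ω J

/-- The current `U = W L⁻¹ W̄`. -/
def cartanU (c : k) (ω J : M) (L : Mˣ) : M := cartanW c ω J * ↑L⁻¹ * cartanWBar c ω J

theorem cartanU_eq (c : k) (ω J : M) (L : Mˣ) :
    cartanU c ω J L = ↑L⁻¹ * cartanWBar c ω J + c • (ω * cartanThetaStar c ω J L) := by
  simp only [cartanU, cartanW, cartanThetaStar, add_mul, one_mul, smul_mul_assoc, mul_assoc]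

theorem map_cartanW {M' : Type*} [Ring M'] [Algebra k M'] (f : M →ₐ[k] M') (c : k) (ω J : M) :
    f (cartanW c ω J) = cartanW c (f ω) (f J) := by
  simp [cartanW]

theorem map_cartanWBar {M' : Type*} [Ring M'] [Algebra k M'] (f : M →ₐ[k] M') (c : k)
    (ω J : M) : f (cartanWBar c ω J) = cartanWBar c (f ω) (f J) := by
  simp [cartanWBar]

theorem map_cartanTheta {M' : Type*} [Ring M'] [Algebra k M'] (f : M →ₐ[k] M') (ω : M)
    (L W : Mˣ) :
    f (cartanTheta ω L W) =
      cartanTheta (f ω) (Units.map (f : M →* M') L) (Units.map (f : M →* M') W) := by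
  simp [cartanTheta, ← map_inv]

theorem map_cartanThetaStar {M' : Type*} [Ring M'] [Algebra k M'] (f : M →ₐ[k] M') (c : k)
    (ω J : M) (L : Mˣ) :
    f (cartanThetaStar c ω J L) =
      cartanThetaStar c (f ω) (f J) (Units.map (f : M →* M') L) := by
  simp [cartanThetaStar, map_cartanWBar, ← map_inv]

theorem map_cartanU {M' : Type*} [Ring M'] [Algebra k M'] (f : M →ₐ[k] M') (c : k)
    (ω J : M) (L : Mˣ) :
    f (cartanU c ω J L) = cartanU c (f ω) (f J) (Units.map (f : M →* M') L) := by
  simp [cartanU, map_cartanW, map_cartanWBar, ← map_inv]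

section Commute

variable {c : k} {X ω J : M} {L W : Mˣ}

theorem commute_cartanW (hω : Commute X ω) (hJ : Commute X J) :
    Commute X (cartanW c ω J) :=
  (Commute.one_right _).add_right ((hω.mul_right hJ).smul_right c)

theorem commute_cartanWBar (hω : Commute X ω) (hJ : Commute X J) :
    Commute X (cartanWBar c ω J) :=
  (Commute.one_right _).add_right ((hJ.mul_right hω).smul_right c)

theorem commute_cartanTheta (hω : Commute X ω) (hL : Commute X L) (hW : Commute X W) :
    Commute X (cartanTheta ω L W) :=
  (hω.mul_right hL).mul_right hW.units_inv_right

theorem commute_cartanThetaStar (hω : Commute X ω) (hJ : Commute X J) (hL : Commute X L) :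
    Commute X (cartanThetaStar c ω J L) :=
  (hJ.mul_right hL.units_inv_right).mul_right (commute_cartanWBar hω hJ)

theorem commute_cartanU (hω : Commute X ω) (hJ : Commute X J) (hL : Commute X L) :
    Commute X (cartanU c ω J L) :=
  ((commute_cartanW hω hJ).mul_right hL.units_inv_right).mul_right (commute_cartanWBar hω hJ)

end Commute

theorem anticomm_cartanThetaStar {c : k} {s a b ω J : M} {L : Mˣ}
    (hJ : s * J + J * s = -a) (hω : s * ω + ω * s = b) (hL : Commute s L) :
    s * cartanThetaStar c ω J L + cartanThetaStar c ω J L * s =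
      c • (J * ↑L⁻¹ * (a * ω + J * b)) - a * ↑L⁻¹ * cartanWBar c ω J := by
  have hsL : s * ↑L⁻¹ = ↑L⁻¹ * s := hL.units_inv_right
  have hWBar : cartanWBar c ω J * s = s * cartanWBar c ω J + c • (a * ω + J * b) := by
    have : J * ω * s = s * J * ω + (a * ω + J * b) := by
      rw [← hω, eq_sub_of_add_eq hJ]
      noncomm_ring
    simp only [cartanWBar, add_mul, mul_add, one_mul, mul_one, smul_mul_assoc, mul_smul_comm,
      this, ← mul_assoc, smul_add]
    abel
  calc s * (J * ↑L⁻¹ * cartanWBar c ω J) + J * ↑L⁻¹ * cartanWBar c ω J * s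
      = s * J * ↑L⁻¹ * cartanWBar c ω J + J * (↑L⁻¹ * s) * cartanWBar c ω J +
          c • (J * ↑L⁻¹ * (a * ω + J * b)) := by
        rw [mul_assoc (J * _), hWBar]
        simp only [mul_add, mul_smul_comm, mul_assoc, add_assoc]
    _ = (s * J + J * s) * ↑L⁻¹ * cartanWBar c ω J + c • (J * ↑L⁻¹ * (a * ω + J * b)) := by
        rw [← hsL]
        simp only [add_mul, mul_assoc]
    _ = _ := by
        rw [hJ]
        simp only [neg_mul]
        abel

theorem exchange_of_commute {R : Mˣ} {X L : M} (hX : Commute (R * L * R : M) X) :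
    ↑R⁻¹ * X * R * L = L * R * X * ↑R⁻¹ := by
  have := congrArg (fun Y : M => ↑R⁻¹ * Y * ↑R⁻¹) hX.symm.eq
  simpa only [mul_assoc, Units.inv_mul_cancel_left, Units.mul_inv, mul_one] using this

theorem inv_exchange_of_commute {R L : Mˣ} {X : M} (hX : Commute (R * L * R : M) X) :
    ↑L⁻¹ * ↑R⁻¹ * X * R = R * X * ↑R⁻¹ * ↑L⁻¹ := by
  have := congrArg (fun Y : M => ↑L⁻¹ * Y * ↑L⁻¹) (exchange_of_commute hX)
  simpa only [mul_assoc, Units.inv_mul_cancel_left, Units.mul_inv, mul_one] using this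

theorem mul_self_sub_smul_eq_one {R : Mˣ} {c : k} (hR : (R : M) = ↑R⁻¹ + c • 1) :
    (R * R - c • R : M) = 1 := by
  have : (R * R : M) = R * (↑R⁻¹ + c • 1) := by rw [← hR]
  rw [this, mul_add, Units.mul_inv, mul_smul_comm, mul_one, add_sub_cancel_right]

namespace CartanRelations

variable {c : k} {R : Mˣ} {ω J : M}

section Reordering

variable {L : M} (h : CartanRelations (R : M) ↑R⁻¹ ω J L)
include h

theorem commute_omega : Commute (R * L * R) ω := by
  simpa only [commute_iff_eq, ← mul_assoc] using h.omega_L.symm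

theorem commute_J : Commute (R * L * R) J := by
  simpa only [commute_iff_eq, ← mul_assoc] using h.J_L.symm

theorem commute_L : Commute (R * L * R) L := by
  simpa only [commute_iff_eq, ← mul_assoc] using h.L_L.symm

theorem J_mul_omega : J * R * ω = -1 - ↑R⁻¹ * ω * R * J * R := by
  have := congrArg (fun X : M => ↑R⁻¹ * X) h.omega_J
  simp only [mul_add, mul_neg, mul_assoc, Units.inv_mul_cancel_left, Units.inv_mul] at this
  simp only [mul_assoc]
  exact eq_sub_of_add_eq' this

theorem omega_mul_J : ω * R * J = -1 - R * J * R * ω * ↑R⁻¹ := by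
  have := congrArg (fun X : M => X * ↑R⁻¹) h.omega_J
  simp only [add_mul, neg_mul, mul_assoc, Units.mul_inv, mul_one] at this
  simp only [mul_assoc]
  exact eq_sub_of_add_eq this

theorem inv_conj_omega_J : ↑R⁻¹ * ω * R * J + J * R * ω * ↑R⁻¹ = -↑R⁻¹ := by
  have := congrArg (fun X : M => X * ↑R⁻¹) h.J_mul_omega
  simp only [sub_mul, neg_mul, one_mul, mul_assoc, Units.mul_inv, mul_one] at this
  simp only [mul_assoc, this]
  abel

variable (hR : (R : M) = ↑R⁻¹ + c • 1)
include hR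

theorem cartanW_omega : R * cartanW c ω J * R * ω = ω * ↑R⁻¹ * cartanW c ω J * R :=
  calc R * cartanW c ω J * R * ω
      = R * R * ω + c • (R * ω * (J * R * ω)) := by
        simp only [cartanW, mul_add, add_mul, mul_one, mul_smul_comm, smul_mul_assoc, mul_assoc]
    _ = (R * R - c • R) * ω - c • (R * ω * (↑R⁻¹ * ω * R * J * R)) := by
        rw [h.J_mul_omega]
        simp only [mul_sub, sub_mul, mul_neg, mul_one, smul_mul_assoc, mul_assoc]
        module
    _ = ω - c • (R * (ω * ↑R⁻¹ * ω * R) * J * R) := by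
        rw [mul_self_sub_smul_eq_one hR, one_mul]
        simp only [mul_assoc]
    _ = ω + c • (ω * ↑R⁻¹ * ω * J * R) := by
        rw [h.omega_omega]
        simp only [mul_neg, neg_mul, smul_neg, sub_neg_eq_add, mul_assoc,
          Units.mul_inv_cancel_left]
    _ = ω * ↑R⁻¹ * cartanW c ω J * R := by
        simp only [cartanW, mul_add, add_mul, mul_one, mul_smul_comm, smul_mul_assoc, mul_assoc,
          Units.inv_mul]

theorem cartanWBar_omega : R * cartanWBar c ω J * ↑R⁻¹ * ω = ω * R * cartanWBar c ω J * R := by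
  symm
  calc ω * R * cartanWBar c ω J * R
      = ω * (R * R) + c • (ω * R * J * (ω * R)) := by
        simp only [cartanWBar, mul_add, add_mul, mul_one, mul_smul_comm, smul_mul_assoc,
          mul_assoc]
    _ = ω * (R * R - c • R) - c • (R * J * R * (ω * ↑R⁻¹ * ω * R)) := by
        rw [h.omega_mul_J]
        simp only [mul_sub, sub_mul, neg_mul, one_mul, mul_smul_comm, mul_assoc]
        module
    _ = ω + c • (R * J * ω * ↑R⁻¹ * ω) := by
        rw [mul_self_sub_smul_eq_one hR, mul_one, h.omega_omega]
        simp only [mul_neg, smul_neg, sub_neg_eq_add, mul_assoc, Units.mul_inv_cancel_left]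
    _ = R * cartanWBar c ω J * ↑R⁻¹ * ω := by
        simp only [cartanWBar, mul_add, add_mul, mul_one, mul_smul_comm, smul_mul_assoc,
          mul_assoc, Units.mul_inv_cancel_left]

theorem cartanW_J : ↑R⁻¹ * cartanW c ω J * R * J = J * R * cartanW c ω J * R := by
  symm
  calc J * R * cartanW c ω J * R
      = J * (R * R) + c • (J * R * ω * (J * R)) := by
        simp only [cartanW, mul_add, add_mul, mul_one, mul_smul_comm, smul_mul_assoc, mul_assoc]
    _ = J * (R * R - c • R) - c • (↑R⁻¹ * ω * R * (J * R * J * R)) := by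
        rw [h.J_mul_omega]
        simp only [mul_sub, sub_mul, neg_mul, one_mul, mul_smul_comm, mul_assoc]
        module
    _ = J + c • (↑R⁻¹ * ω * J * R * J) := by
        rw [mul_self_sub_smul_eq_one hR, mul_one, h.J_J]
        simp only [mul_neg, smul_neg, sub_neg_eq_add, mul_assoc, Units.mul_inv_cancel_left]
    _ = ↑R⁻¹ * cartanW c ω J * R * J := by
        simp only [cartanW, mul_add, add_mul, mul_one, mul_smul_comm, smul_mul_assoc, mul_assoc,
          Units.inv_mul_cancel_left]

theorem cartanWBar_J : R * cartanWBar c ω J * R * J = J * R * cartanWBar c ω J * ↑R⁻¹ :=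
  calc R * cartanWBar c ω J * R * J
      = R * R * J + c • (R * J * (ω * R * J)) := by
        simp only [cartanWBar, mul_add, add_mul, mul_one, mul_smul_comm, smul_mul_assoc,
          mul_assoc]
    _ = (R * R - c • R) * J - c • (R * (J * R * J * R) * ω * ↑R⁻¹) := by
        rw [h.omega_mul_J]
        simp only [mul_sub, sub_mul, mul_neg, mul_one, smul_mul_assoc, mul_assoc]
        module
    _ = J + c • (J * R * J * ω * ↑R⁻¹) := by
        rw [mul_self_sub_smul_eq_one hR, one_mul, h.J_J]
        simp only [mul_neg, neg_mul, smul_neg, sub_neg_eq_add, mul_assoc,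
          Units.mul_inv_cancel_left]
    _ = J * R * cartanWBar c ω J * ↑R⁻¹ := by
        simp only [cartanWBar, mul_add, add_mul, mul_one, mul_smul_comm, smul_mul_assoc,
          mul_assoc, Units.mul_inv]

end Reordering

section Current

variable {L : Mˣ} (h : CartanRelations (R : M) ↑R⁻¹ ω J L) (hR : (R : M) = ↑R⁻¹ + c • 1)
include h hR

theorem cartanU_omega :
    R * cartanU c ω J L * ↑R⁻¹ * ω = ω * ↑R⁻¹ * cartanU c ω J L * R := by
  set W := cartanW c ω J
  set WBar := cartanWBar c ω J
  calc R * (W * ↑L⁻¹ * WBar) * ↑R⁻¹ * ω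
      = R * W * ↑L⁻¹ * ↑R⁻¹ * (R * WBar * ↑R⁻¹ * ω) := by
        simp only [mul_assoc, Units.inv_mul_cancel_left]
    _ = R * W * (↑L⁻¹ * ↑R⁻¹ * ω * R) * WBar * R := by
        rw [h.cartanWBar_omega hR]
        simp only [mul_assoc, WBar]
    _ = R * W * R * ω * ↑R⁻¹ * ↑L⁻¹ * WBar * R := by
        rw [inv_exchange_of_commute h.commute_omega]
        simp only [mul_assoc]
    _ = ω * ↑R⁻¹ * (W * ↑L⁻¹ * WBar) * R := by
        rw [h.cartanW_omega hR]
        simp only [mul_assoc, Units.mul_inv_cancel_left, W]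

theorem cartanU_J :
    ↑R⁻¹ * cartanU c ω J L * R * J = J * R * cartanU c ω J L * ↑R⁻¹ := by
  set W := cartanW c ω J
  set WBar := cartanWBar c ω J
  calc ↑R⁻¹ * (W * ↑L⁻¹ * WBar) * R * J
      = ↑R⁻¹ * W * ↑L⁻¹ * ↑R⁻¹ * (R * WBar * R * J) := by
        simp only [mul_assoc, Units.inv_mul_cancel_left]
    _ = ↑R⁻¹ * W * (↑L⁻¹ * ↑R⁻¹ * J * R) * WBar * ↑R⁻¹ := by
        rw [h.cartanWBar_J hR]
        simp only [mul_assoc, WBar]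
    _ = ↑R⁻¹ * W * R * J * ↑R⁻¹ * ↑L⁻¹ * WBar * ↑R⁻¹ := by
        rw [inv_exchange_of_commute h.commute_J]
        simp only [mul_assoc]
    _ = J * R * (W * ↑L⁻¹ * WBar) * ↑R⁻¹ := by
        rw [h.cartanW_J hR]
        simp only [mul_assoc, Units.mul_inv_cancel_left, W]

theorem commute_cartanW_conj_cartanU :
    Commute (cartanW c ω J) (R * cartanU c ω J L * ↑R⁻¹) := by
  set U := cartanU c ω J L
  refine (Commute.one_left _).add_left (Commute.smul_left (Eq.symm ?_) c)
  calc R * U * ↑R⁻¹ * (ω * J)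
      = R * U * ↑R⁻¹ * ω * J := (mul_assoc _ _ _).symm
    _ = ω * (↑R⁻¹ * U * R * J) := by rw [h.cartanU_omega hR]; simp only [mul_assoc, U]
    _ = ω * J * (R * U * ↑R⁻¹) := by rw [h.cartanU_J hR]; simp only [mul_assoc, U]

theorem commute_cartanWBar_conj_cartanU :
    Commute (cartanWBar c ω J) (↑R⁻¹ * cartanU c ω J L * R) := by
  set U := cartanU c ω J L
  refine (Commute.one_left _).add_left (Commute.smul_left (Eq.symm ?_) c)
  calc ↑R⁻¹ * U * R * (J * ω)
      = ↑R⁻¹ * U * R * J * ω := (mul_assoc _ _ _).symm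
    _ = J * (R * U * ↑R⁻¹ * ω) := by rw [h.cartanU_J hR]; simp only [mul_assoc, U]
    _ = J * ω * (↑R⁻¹ * U * R) := by rw [h.cartanU_omega hR]; simp only [mul_assoc, U]

theorem cartanU_conj_mul_cartanU :
    R * cartanU c ω J L * ↑R⁻¹ * cartanU c ω J L =
      cartanU c ω J L * ↑R⁻¹ * cartanU c ω J L * R := by
  set U := cartanU c ω J L
  set W := cartanW c ω J
  set WBar := cartanWBar c ω J
  have hL : ↑L⁻¹ * ↑R⁻¹ * U * R = R * U * ↑R⁻¹ * ↑L⁻¹ :=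
    inv_exchange_of_commute (commute_cartanU h.commute_omega h.commute_J h.commute_L)
  calc R * U * ↑R⁻¹ * (W * ↑L⁻¹ * WBar)
      = R * U * ↑R⁻¹ * W * ↑L⁻¹ * WBar := by simp only [mul_assoc]
    _ = W * (R * U * ↑R⁻¹ * ↑L⁻¹) * WBar := by
        rw [← (h.commute_cartanW_conj_cartanU hR).eq]; simp only [mul_assoc, U, W]
    _ = W * ↑L⁻¹ * (↑R⁻¹ * U * R * WBar) := by rw [← hL]; simp only [mul_assoc]
    _ = W * ↑L⁻¹ * WBar * ↑R⁻¹ * U * R := by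
        rw [← (h.commute_cartanWBar_conj_cartanU hR).eq]; simp only [mul_assoc, U, WBar]

theorem cartanU_reflection :
    ↑R⁻¹ * cartanU c ω J L * ↑R⁻¹ * cartanU c ω J L =
      cartanU c ω J L * ↑R⁻¹ * cartanU c ω J L * ↑R⁻¹ := by
  have := h.cartanU_conj_mul_cartanU hR
  rw [hR] at this
  simpa only [add_mul, mul_add, smul_mul_assoc, mul_smul_comm, one_mul, mul_one,
    add_left_inj] using this

end Current

section Theta

variable {L W : Mˣ} (h : CartanRelations (R : M) ↑R⁻¹ ω J L) (hR : (R : M) = ↑R⁻¹ + c • 1)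
include h hR

theorem cartanW_reflection : Commute (cartanW c ω J) (R * cartanW c ω J * R) := by
  set W := cartanW c ω J with hW
  have key : R * W * R * (ω * J) = ω * J * (R * W * R) :=
    calc R * W * R * (ω * J)
        = R * W * R * ω * J := (mul_assoc _ _ _).symm
      _ = ω * (↑R⁻¹ * W * R * J) := by rw [h.cartanW_omega hR]; simp only [mul_assoc, W]
      _ = ω * J * (R * W * R) := by rw [h.cartanW_J hR]; simp only [mul_assoc, W]
  rw [hW, cartanW]
  exact (Commute.one_left _).add_left (Commute.smul_left (Eq.symm key) c)

theorem inv_conj_omega_mul_J :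
    ↑R⁻¹ * ω * ↑R⁻¹ * J = -(J * R * ω * ↑R⁻¹) - ↑R⁻¹ * cartanW c ω J := by
  calc ↑R⁻¹ * ω * ↑R⁻¹ * J
      = ↑R⁻¹ * ω * R * J - c • (↑R⁻¹ * ω * J) := by
        rw [← sub_eq_iff_eq_add.mpr hR]
        simp only [mul_sub, sub_mul, mul_smul_comm, smul_mul_assoc, mul_one]
    _ = -(J * R * ω * ↑R⁻¹) - ↑R⁻¹ * cartanW c ω J := by
        rw [eq_sub_of_add_eq h.inv_conj_omega_J]
        simp only [cartanW, mul_add, mul_one, mul_smul_comm, mul_assoc]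
        abel

variable (hW : W = cartanW c ω J)
include hW

theorem inv_cartanW_mul_J : ↑W⁻¹ * R * J = R * J * ↑R⁻¹ * ↑W⁻¹ * ↑R⁻¹ := by
  have := congrArg (fun X : M => ↑W⁻¹ * R * X * ↑R⁻¹ * ↑W⁻¹ * ↑R⁻¹) (h.cartanW_J hR)
  simpa only [← hW, mul_assoc, Units.mul_inv, Units.mul_inv_cancel_left,
    Units.inv_mul_cancel_left, mul_one] using this.symm

theorem inv_cartanW_mul_omega : ↑W⁻¹ * ↑R⁻¹ * ω = R * ω * ↑R⁻¹ * ↑W⁻¹ * R := by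
  have := congrArg (fun X : M => ↑W⁻¹ * ↑R⁻¹ * X * ↑R⁻¹ * ↑W⁻¹ * R) (h.cartanW_omega hR)
  simpa only [← hW, mul_assoc, Units.mul_inv, Units.mul_inv_cancel_left,
    Units.inv_mul_cancel_left, Units.inv_mul, mul_one] using this.symm

theorem inv_cartanW_conj_cartanW :
    (↑W⁻¹ * ↑R⁻¹ * W : M) = R * W * ↑R⁻¹ * ↑W⁻¹ * ↑R⁻¹ := by
  have := congrArg (fun X : M => ↑W⁻¹ * ↑R⁻¹ * X * ↑R⁻¹ * ↑W⁻¹ * ↑R⁻¹)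
    (h.cartanW_reflection hR).eq
  simpa only [← hW, mul_assoc, Units.mul_inv, Units.mul_inv_cancel_left,
    Units.inv_mul_cancel_left, Units.inv_mul, mul_one] using this

theorem cartanTheta_J :
    ↑R⁻¹ * cartanTheta ω L W * R * J + J * R * cartanTheta ω L W * ↑R⁻¹ =
      -(L * ↑W⁻¹ * ↑R⁻¹ * W) := by
  have hJL : L * R * J * ↑R⁻¹ = ↑R⁻¹ * J * R * L := (exchange_of_commute h.commute_J).symm
  have hWL : (L * R * W * ↑R⁻¹ : M) = ↑R⁻¹ * W * R * L :=
    (exchange_of_commute (hW ▸ commute_cartanW h.commute_omega h.commute_J)).symm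
  rw [← eq_sub_iff_add_eq]
  calc ↑R⁻¹ * (ω * L * ↑W⁻¹) * R * J
      = ↑R⁻¹ * ω * L * (↑W⁻¹ * R * J) := by simp only [mul_assoc]
    _ = ↑R⁻¹ * ω * (L * R * J * ↑R⁻¹) * ↑W⁻¹ * ↑R⁻¹ := by
        rw [h.inv_cartanW_mul_J hR hW]
        simp only [mul_assoc]
    _ = ↑R⁻¹ * ω * ↑R⁻¹ * J * R * L * ↑W⁻¹ * ↑R⁻¹ := by
        rw [hJL]; simp only [mul_assoc]
    _ = -(J * R * (ω * L * ↑W⁻¹) * ↑R⁻¹) - (↑R⁻¹ * W * R * L) * ↑W⁻¹ * ↑R⁻¹ := by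
        rw [h.inv_conj_omega_mul_J hR, ← hW]
        simp only [sub_mul, neg_mul, mul_assoc, Units.inv_mul_cancel_left]
    _ = -(J * R * (ω * L * ↑W⁻¹) * ↑R⁻¹) - L * (R * W * ↑R⁻¹ * ↑W⁻¹ * ↑R⁻¹) := by
        rw [← hWL]
        simp only [mul_assoc]
    _ = -(L * ↑W⁻¹ * ↑R⁻¹ * W) - J * R * (ω * L * ↑W⁻¹) * ↑R⁻¹ := by
        rw [← h.inv_cartanW_conj_cartanW hR hW]
        simp only [mul_assoc]
        abel

theorem cartanTheta_omega :
    R * cartanTheta ω L W * ↑R⁻¹ * ω = -(ω * ↑R⁻¹ * cartanTheta ω L W * R) := by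
  have hωL : L * R * ω * ↑R⁻¹ = ↑R⁻¹ * ω * R * L := (exchange_of_commute h.commute_omega).symm
  calc R * (ω * L * ↑W⁻¹) * ↑R⁻¹ * ω
      = R * ω * L * (↑W⁻¹ * ↑R⁻¹ * ω) := by simp only [mul_assoc]
    _ = R * ω * (L * R * ω * ↑R⁻¹) * ↑W⁻¹ * R := by
        rw [h.inv_cartanW_mul_omega hR hW]
        simp only [mul_assoc]
    _ = R * (ω * ↑R⁻¹ * ω * R) * L * ↑W⁻¹ * R := by
        rw [hωL]
        simp only [mul_assoc]
    _ = -(ω * ↑R⁻¹ * (ω * L * ↑W⁻¹) * R) := by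
        rw [h.omega_omega]
        simp only [mul_neg, neg_mul, mul_assoc, Units.mul_inv_cancel_left]

omit hW

theorem cartanThetaStar_omega :
    R * cartanThetaStar c ω J L * ↑R⁻¹ * ω + ω * R * cartanThetaStar c ω J L * R =
      -(↑L⁻¹ * cartanWBar c ω J * R) := by
  set WBar := cartanWBar c ω J
  rw [← eq_sub_iff_add_eq]
  calc R * (J * ↑L⁻¹ * WBar) * ↑R⁻¹ * ω
      = R * J * ↑L⁻¹ * ↑R⁻¹ * (R * WBar * ↑R⁻¹ * ω) := by
        simp only [mul_assoc, Units.inv_mul_cancel_left]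
    _ = R * J * (↑L⁻¹ * ↑R⁻¹ * ω * R) * WBar * R := by
        rw [h.cartanWBar_omega hR]
        simp only [mul_assoc, WBar]
    _ = R * (J * R * ω) * ↑R⁻¹ * ↑L⁻¹ * WBar * R := by
        rw [inv_exchange_of_commute h.commute_omega]
        simp only [mul_assoc]
    _ = -(↑L⁻¹ * WBar * R) - ω * R * (J * ↑L⁻¹ * WBar) * R := by
        rw [h.J_mul_omega]
        simp only [mul_sub, sub_mul, mul_neg, neg_mul, mul_one, mul_assoc,
          Units.mul_inv_cancel_left]

end Theta
end CartanRelations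

end Exchange

section RMatrix

variable {k : Type*} [Field k] {A : Type*} [Ring A] [Algebra k A] {q : k} {N : ℕ}

theorem lam_ne_zero (hq : q ≠ 0) (hq1 : q ^ 2 ≠ 1) : lam q ≠ 0 := by
  rw [lam, sub_ne_zero, ne_eq, ← mul_eq_one_iff_eq_inv₀ hq, ← pow_two]
  exact hq1

theorem RHat_apply (q : k) (a b c d : Fin N) :
    RHat q N (a, b) (c, d) =
      (if b = c then if a = d then if a = b then q else 1 else 0 else 0)
        + (if a = c then if b = d then if a < b then lam q else 0 else 0 else 0) := by
  have hP : RHat q N (a, b) (c, d) = RMat q N (b, a) (c, d) := by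
    simp [RHat, Matrix.mul_apply, PMat, Fintype.sum_prod_type, ite_and]
  have hdiag : 1 + (q - 1) * (if b = a then 1 else 0) = if a = b then q else 1 := by
    simp only [eq_comm (a := b)]
    split_ifs <;> ring
  rw [hP, RMat, Matrix.of_apply, hdiag]
  simp only [and_comm (a := b = d)]
  simp only [lam, ite_and, mul_ite, mul_one, mul_zero]

theorem RA_mul_apply (q : k) (X : Matrix (Fin N × Fin N) (Fin N × Fin N) A) (a b : Fin N)
    (y : Fin N × Fin N) :
    (RA A q N * X) (a, b) y =
      (if a = b then q else 1) • X (b, a) y + (if a < b then lam q else 0) • X (a, b) y := by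
  simp [Matrix.mul_apply, RA, RHat_apply, Fintype.sum_prod_type, add_mul,
    Finset.sum_add_distrib, apply_ite (algebraMap k A), ite_mul, Algebra.smul_def]

theorem mul_RA_apply (q : k) (X : Matrix (Fin N × Fin N) (Fin N × Fin N) A) (a b : Fin N)
    (x : Fin N × Fin N) :
    (X * RA A q N) x (a, b) =
      (if a = b then q else 1) • X x (b, a) + (if a < b then lam q else 0) • X x (a, b) := by
  have hcomm (e : k) (z : A) : z * algebraMap k A e = e • z := by
    rw [Algebra.smul_def, Algebra.commutes]
  simp only [Matrix.mul_apply, RA, Matrix.map_apply, hcomm, Fintype.sum_prod_type, RHat_apply,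
    add_smul, Finset.sum_add_distrib, ite_smul, zero_smul, Finset.sum_ite_eq',
    Finset.mem_univ, if_true]
  simp [eq_comm]

theorem RA_self (q : k) (N : ℕ) : RA k q N = RHat q N := by
  ext
  simp [RA]

theorem RHat_mul_RHat_sub (hq : q ≠ 0) : RHat q N * (RHat q N - lam q • 1) = 1 := by
  rw [mul_sub, mul_smul_comm, mul_one]
  ext ⟨a, b⟩ y
  have hR (a b : Fin N) : RHat q N (a, b) y =
      (if a = b then q else 1) * (1 : Matrix (Fin N × Fin N) (Fin N × Fin N) k) (b, a) y
        + (if a < b then lam q else 0) *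
          (1 : Matrix (Fin N × Fin N) (Fin N × Fin N) k) (a, b) y := by
    simpa [RA_self] using RA_mul_apply q (1 : Matrix (Fin N × Fin N) (Fin N × Fin N) k) a b y
  have hRR := RA_mul_apply q (RHat q N) a b y
  rw [RA_self] at hRR
  simp only [Matrix.sub_apply, Matrix.smul_apply, hRR, hR, smul_eq_mul]
  rcases lt_trichotomy a b with hab | rfl | hab
  · simp [hab, hab.ne, hab.ne', hab.not_gt]
  · simp only [if_true, lt_irrefl, if_false, lam]
    field_simp
    ring
  · simp [hab, hab.ne, hab.ne', hab.not_gt]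

theorem RHat_inv (hq : q ≠ 0) : (RHat q N)⁻¹ = RHat q N - lam q • 1 :=
  Matrix.inv_eq_right_inv (RHat_mul_RHat_sub hq)

variable (A N) in
theorem RA_eq_RAInv_add (hq : q ≠ 0) : RA A q N = RAInv A q N + lam q • 1 := by
  ext a b
  simp only [RA, RAInv, RHat_inv hq, Matrix.map_apply, Matrix.sub_apply, Matrix.add_apply,
    Matrix.smul_apply, Matrix.one_apply, map_sub]
  split_ifs <;> simp [Algebra.smul_def]

variable (A N) in
theorem RAInv_eq_RA_sub (hq : q ≠ 0) : RAInv A q N = RA A q N - lam q • 1 :=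
  eq_sub_of_add_eq (RA_eq_RAInv_add A N hq).symm

variable (A N) in
/-- `R̂` as a unit of the ring of matrices over `A`. -/
def RAUnit (hq : q ≠ 0) : (Matrix (Fin N × Fin N) (Fin N × Fin N) A)ˣ where
  val := RA A q N
  inv := RAInv A q N
  val_inv := by
    rw [RA, RAInv, ← Matrix.map_mul, RHat_inv hq, RHat_mul_RHat_sub hq,
      Matrix.map_one _ (map_zero _) (map_one _)]
  inv_val := by
    rw [RA, RAInv, ← Matrix.map_mul, RHat_inv hq, mul_eq_one_comm.mp (RHat_mul_RHat_sub hq),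
      Matrix.map_one _ (map_zero _) (map_one _)]

theorem mul_RAInv_apply (hq : q ≠ 0) (X : Matrix (Fin N × Fin N) (Fin N × Fin N) A)
    (a b : Fin N) (x : Fin N × Fin N) :
    (X * RAInv A q N) x (a, b) =
      (if a = b then q⁻¹ else 1) • X x (b, a) - (if b < a then lam q else 0) • X x (a, b) := by
  rw [RAInv_eq_RA_sub A N hq, mul_sub, mul_smul_comm, mul_one, Matrix.sub_apply, mul_RA_apply,
    Matrix.smul_apply]
  rcases lt_trichotomy a b with hab | rfl | hab
  · simp [hab, hab.ne, hab.not_gt]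
  · simp only [if_true, lt_irrefl, if_false, lam]
    module
  · simp [hab, hab.ne', hab.not_gt]

theorem sp2_apply (X : Matrix (Fin N) (Fin N) A) (a b c d : Fin N) :
    sp2 X (a, b) (c, d) = if a = c then X b d else 0 := by
  simp [sp2, Matrix.kroneckerMap_apply, Matrix.one_apply]

theorem mul_sp2_apply (M : Matrix (Fin N × Fin N) (Fin N × Fin N) A)
    (X : Matrix (Fin N) (Fin N) A) (x : Fin N × Fin N) (c d : Fin N) :
    (M * sp2 X) x (c, d) = ∑ b, M x (c, b) * X b d := by
  simp [Matrix.mul_apply, Fintype.sum_prod_type_right, sp2_apply]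

theorem sp2_mul_apply (M : Matrix (Fin N × Fin N) (Fin N × Fin N) A)
    (X : Matrix (Fin N) (Fin N) A) (x : Fin N × Fin N) (a b : Fin N) :
    (sp2 X * M) (a, b) x = ∑ c, X b c * M (a, c) x := by
  simp [Matrix.mul_apply, Fintype.sum_prod_type_right, sp2_apply]

theorem sp2_mul (X Y : Matrix (Fin N) (Fin N) A) : sp2 (X * Y) = sp2 X * sp2 Y := by
  ext ⟨a, b⟩ ⟨c, d⟩
  rw [mul_sp2_apply]
  simp [sp2_apply, Matrix.mul_apply]

variable (k) in
/-- `X ↦ X₂` as an algebra homomorphism. -/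
def sp2AlgHom : Matrix (Fin N) (Fin N) A →ₐ[k] Matrix (Fin N × Fin N) (Fin N × Fin N) A :=
  AlgHom.ofLinearMap
    { toFun := sp2
      map_add' := Matrix.kronecker_add 1
      map_smul' := fun c X => by
        ext ⟨a, b⟩ ⟨a', b'⟩
        simp [sp2_apply] }
    Matrix.one_kronecker_one sp2_mul

variable (k) in
/-- `L₂` as a unit, for an invertible matrix `L`. -/
def sp2Unit (L : (Matrix (Fin N) (Fin N) A)ˣ) : (Matrix (Fin N × Fin N) (Fin N × Fin N) A)ˣ :=
  Units.map (sp2AlgHom k (A := A) (N := N)) L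

theorem sp2_cartanU (c : k) (ω J : Matrix (Fin N) (Fin N) A)
    (L : (Matrix (Fin N) (Fin N) A)ˣ) :
    sp2 (cartanU c ω J L) = cartanU c (sp2 ω) (sp2 J) (sp2Unit k L) :=
  map_cartanU (sp2AlgHom k) c ω J L

theorem sp2_cartanThetaStar (c : k) (ω J : Matrix (Fin N) (Fin N) A)
    (L : (Matrix (Fin N) (Fin N) A)ˣ) :
    sp2 (cartanThetaStar c ω J L) = cartanThetaStar c (sp2 ω) (sp2 J) (sp2Unit k L) :=
  map_cartanThetaStar (sp2AlgHom k) c ω J L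

variable (k) in
theorem sp2_cartanTheta (ω : Matrix (Fin N) (Fin N) A) (L W : (Matrix (Fin N) (Fin N) A)ˣ) :
    sp2 (cartanTheta ω L W) = cartanTheta (sp2 ω) (sp2Unit k L) (sp2Unit k W) :=
  map_cartanTheta (sp2AlgHom k) ω L W

theorem sp2_cartanW (c : k) (ω J : Matrix (Fin N) (Fin N) A) :
    sp2 (cartanW c ω J) = cartanW c (sp2 ω) (sp2 J) :=
  map_cartanW (sp2AlgHom k) c ω J

theorem sp2_cartanWBar (c : k) (ω J : Matrix (Fin N) (Fin N) A) :
    sp2 (cartanWBar c ω J) = cartanWBar c (sp2 ω) (sp2 J) :=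
  map_cartanWBar (sp2AlgHom k) c ω J

theorem sp2Unit_eq_cartanW {c : k} {ω J : Matrix (Fin N) (Fin N) A}
    {W : (Matrix (Fin N) (Fin N) A)ˣ} (hW : (W : Matrix (Fin N) (Fin N) A) = cartanW c ω J) :
    (sp2Unit k W).val = cartanW c (sp2 ω) (sp2 J) :=
  (congrArg sp2 hW).trans (sp2_cartanW c ω J)

end RMatrix

section QuantumTrace

variable {k : Type*} [Field k] {A : Type*} [Ring A] [Algebra k A] {q : k} {N : ℕ}

theorem qTr_eq_sum (X : Matrix (Fin N) (Fin N) A) : qTr q X = ∑ m, DInv q N m m • X m m := by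
  simp [qTr, DInv, Matrix.diagonal_map, Matrix.trace, Matrix.diagonal_mul, Algebra.smul_def]

theorem qTr_add (X Y : Matrix (Fin N) (Fin N) A) : qTr q (X + Y) = qTr q X + qTr q Y := by
  simp [qTr, mul_add]

theorem qTr_neg (X : Matrix (Fin N) (Fin N) A) : qTr q (-X) = -qTr q X := by
  simp [qTr]

theorem qTr_sub (X Y : Matrix (Fin N) (Fin N) A) : qTr q (X - Y) = qTr q X - qTr q Y := by
  simp [qTr, mul_sub]

theorem qTr_smul (c : k) (X : Matrix (Fin N) (Fin N) A) : qTr q (c • X) = c • qTr q X := by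
  simp [qTr]

theorem qTr_scalar_mul (a : A) (X : Matrix (Fin N) (Fin N) A) :
    qTr q (Matrix.scalar (Fin N) a * X) = a * qTr q X := by
  simp [qTr_eq_sum, Matrix.scalar_apply, Matrix.diagonal_mul, Finset.mul_sum]

theorem qTr_mul_scalar (a : A) (X : Matrix (Fin N) (Fin N) A) :
    qTr q (X * Matrix.scalar (Fin N) a) = qTr q X * a := by
  simp [qTr_eq_sum, Matrix.scalar_apply, Matrix.mul_diagonal, Finset.sum_mul]

theorem commute_qTr_of_commute_scalar {a : A} {X : Matrix (Fin N) (Fin N) A}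
    (h : Commute (Matrix.scalar (Fin N) a) X) : Commute a (qTr q X) := by
  rw [commute_iff_eq, ← qTr_scalar_mul, h.eq, qTr_mul_scalar]

theorem mul_DInv_apply (q : k) (m : Fin N) : q * DInv q N m m = q ^ (2 * (N - m.val)) := by
  have : N - m.val = N - (m.val + 1) + 1 := by omega
  rw [DInv, Matrix.diagonal_apply_eq, this]
  ring

theorem lam_mul_DInv_apply (hq : q ≠ 0) (m : Fin N) :
    lam q * DInv q N m m = q ^ (2 * (N - m.val)) - q ^ (2 * (N - (m.val + 1))) := by
  rw [lam, sub_mul, mul_DInv_apply, DInv, Matrix.diagonal_apply_eq, pow_succ', ← mul_assoc,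
    inv_mul_cancel₀ hq, one_mul]

theorem lam_mul_sum_DInv_Ico (hq : q ≠ 0) {a b : ℕ} (hab : a ≤ b) (hb : b ≤ N) :
    lam q * ∑ m : Fin N, (if a ≤ m.val ∧ m.val < b then DInv q N m m else 0) =
      q ^ (2 * (N - a)) - q ^ (2 * (N - b)) := by
  let E (n : ℕ) : k := q ^ (2 * (N - n))
  have hIco : (Finset.range N).filter (fun n => a ≤ n ∧ n < b) = Finset.Ico a b := by
    ext n
    simp only [Finset.mem_filter, Finset.mem_range, Finset.mem_Ico]
    omega
  calc lam q * ∑ m : Fin N, (if a ≤ m.val ∧ m.val < b then DInv q N m m else 0)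
      = ∑ m : Fin N, if a ≤ m.val ∧ m.val < b then E m.val - E (m.val + 1) else 0 := by
        simp only [Finset.mul_sum, mul_ite, mul_zero, lam_mul_DInv_apply hq, E]
    _ = ∑ n ∈ Finset.Ico a b, (E n - E (n + 1)) := by
        rw [Fin.sum_univ_eq_sum_range (fun n => if a ≤ n ∧ n < b then E n - E (n + 1) else 0),
          ← Finset.sum_filter, hIco]
    _ = E a - E b := by
        rw [← neg_inj, ← Finset.sum_neg_distrib]
        simp only [neg_sub]
        exact Finset.sum_Ico_sub E hab

theorem lam_mul_sum_DInv (hq : q ≠ 0) :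
    lam q * ∑ m : Fin N, DInv q N m m = q ^ (2 * N) - 1 := by
  simpa using lam_mul_sum_DInv_Ico hq (Nat.zero_le N) le_rfl

variable (q) in
/-- The partial quantum trace over the first of the two tensor factors. -/
def partialQTr : Matrix (Fin N × Fin N) (Fin N × Fin N) A →ₗ[k] Matrix (Fin N) (Fin N) A where
  toFun M := Matrix.of fun i j => ∑ m, DInv q N m m • M (m, i) (m, j)
  map_add' M M' := by
    ext
    simp [Finset.sum_add_distrib]
  map_smul' c M := by
    ext
    simp [Finset.smul_sum, smul_comm c]

theorem partialQTr_apply (M : Matrix (Fin N × Fin N) (Fin N × Fin N) A) (i j : Fin N) :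
    partialQTr q M i j = ∑ m, DInv q N m m • M (m, i) (m, j) := rfl

theorem partialQTr_mul_sp2 (M : Matrix (Fin N × Fin N) (Fin N × Fin N) A)
    (X : Matrix (Fin N) (Fin N) A) : partialQTr q (M * sp2 X) = partialQTr q M * X := by
  ext i j
  rw [Matrix.mul_apply]
  simp only [partialQTr_apply, mul_sp2_apply, Finset.smul_sum, Finset.sum_mul, smul_mul_assoc]
  exact Finset.sum_comm

theorem partialQTr_sp2_mul (M : Matrix (Fin N × Fin N) (Fin N × Fin N) A)
    (X : Matrix (Fin N) (Fin N) A) : partialQTr q (sp2 X * M) = X * partialQTr q M := by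
  ext i j
  rw [Matrix.mul_apply]
  simp only [partialQTr_apply, sp2_mul_apply, Finset.smul_sum, Finset.mul_sum, mul_smul_comm]
  exact Finset.sum_comm

theorem partialQTr_one :
    partialQTr q (1 : Matrix (Fin N × Fin N) (Fin N × Fin N) A) =
      (∑ m : Fin N, DInv q N m m) • 1 := by
  ext i j
  simp [partialQTr_apply, Matrix.one_apply, Finset.sum_smul]

theorem partialQTr_RA (hq : q ≠ 0) : partialQTr q (RA A q N) = q ^ (2 * N) • 1 := by
  ext i j
  have hR (m : Fin N) : RA A q N (m, i) (m, j) =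
      ((if m = i then q else 0) + if m < i then lam q else 0) •
        (1 : Matrix (Fin N) (Fin N) A) i j := by
    rw [← mul_one (RA A q N), RA_mul_apply]
    rcases eq_or_ne m i with rfl | hmi
    · simp [Matrix.one_apply]
    · simp [Matrix.one_apply, hmi, hmi.symm]
  have hsum : ∑ m, DInv q N m m * ((if m = i then q else 0) + if m < i then lam q else 0) =
      q ^ (2 * N) := by
    have hlt := lam_mul_sum_DInv_Ico hq (Nat.zero_le i.val) i.isLt.le
    simp only [Nat.zero_le, true_and, Fin.val_fin_lt, Finset.mul_sum, mul_ite, mul_zero,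
      Nat.sub_zero] at hlt
    simp only [mul_add, Finset.sum_add_distrib, mul_ite, mul_zero, Finset.sum_ite_eq',
      Finset.mem_univ, if_true]
    simp only [mul_comm (DInv q N _ _), hlt, mul_DInv_apply]
    ring
  simp only [partialQTr_apply, hR, smul_smul, ← Finset.sum_smul, hsum, Matrix.smul_apply]

theorem partialQTr_RAInv (hq : q ≠ 0) : partialQTr q (RAInv A q N) = 1 := by
  rw [RAInv_eq_RA_sub A N hq, map_sub, map_smul, partialQTr_one, partialQTr_RA hq, smul_smul,
    lam_mul_sum_DInv hq, ← sub_smul, sub_sub_cancel, one_smul]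

theorem conj_sp2_apply (hq : q ≠ 0) (X : Matrix (Fin N) (Fin N) A) (i j m : Fin N) :
    (RA A q N * sp2 X * RAInv A q N) (m, i) (m, j) =
      (if i = j then X m m else 0) +
        (-(if m = i then if j < i then q * lam q else 0 else 0)
          + (if m = j then if j < i then lam q * q⁻¹ else 0 else 0)
          - lam q * if j < m ∧ m < i then lam q else 0) • X i j := by
  have hdiag : (if m = i then q else 1) • (if m = j then q⁻¹ else 1) •
      (if i = j then X m m else 0) = if i = j then X m m else 0 := by
    split_ifs <;> simp_all
  have hrow : (if m = i then q else 1) • (if j < m then lam q else 0) •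
      (if i = m then X m j else 0) =
        (if m = i then if j < i then q * lam q else 0 else 0) • X i j := by
    rcases eq_or_ne m i with rfl | hmi
    · simp [smul_smul]
    · simp [hmi, hmi.symm]
  have hcol : (if m < i then lam q else 0) • (if m = j then q⁻¹ else 1) •
      (if m = j then X i m else 0) =
        (if m = j then if j < i then lam q * q⁻¹ else 0 else 0) • X i j := by
    rcases eq_or_ne m j with rfl | hmj
    · simp [smul_smul]
    · simp [hmj]
  have hmid : (if m < i then lam q else 0) • (if j < m then lam q else 0) • X i j =
      (lam q * if j < m ∧ m < i then lam q else 0) • X i j := by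
    split_ifs <;> simp_all [smul_smul]
  rw [mul_assoc, RA_mul_apply, mul_RAInv_apply hq, mul_RAInv_apply hq]
  simp only [sp2_apply, if_true, smul_sub, hdiag, hrow, hcol, hmid]
  module

theorem sum_DInv_mul_conj_coeff (hq : q ≠ 0) (i j : Fin N) :
    ∑ m, DInv q N m m *
      (-(if m = i then if j < i then q * lam q else 0 else 0)
        + (if m = j then if j < i then lam q * q⁻¹ else 0 else 0)
        - lam q * if j < m ∧ m < i then lam q else 0) = 0 := by
  rcases lt_or_ge j i with hji | hij
  · have hmid := lam_mul_sum_DInv_Ico hq (a := j.val + 1) (b := i.val) hji i.isLt.le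
    have hDj : DInv q N j j * q⁻¹ = q ^ (2 * (N - (j.val + 1))) := by
      rw [DInv, Matrix.diagonal_apply_eq, pow_succ, mul_inv_cancel_right₀ hq]
    have hDi : DInv q N i i * q = q ^ (2 * (N - i.val)) := by
      rw [mul_comm, mul_DInv_apply]
    simp only [Nat.succ_le_iff, Fin.val_fin_lt, ← hDj, ← hDi] at hmid
    calc _ = -(DInv q N i i * (q * lam q)) + DInv q N j j * (lam q * q⁻¹) -
          lam q * (lam q * ∑ m, if j < m ∧ m < i then DInv q N m m else 0) := by
          simp [hji, mul_add, mul_sub, Finset.sum_add_distrib, Finset.mul_sum, mul_left_comm,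
            mul_comm]
      _ = 0 := by
          rw [hmid]
          ring
  · have hempty (m : Fin N) : ¬(j < m ∧ m < i) := fun h => (h.1.trans h.2).not_ge hij
    simp [hij.not_gt, hempty]

theorem partialQTr_conj (hq : q ≠ 0) (X : Matrix (Fin N) (Fin N) A) :
    partialQTr q (RA A q N * sp2 X * RAInv A q N) = Matrix.scalar (Fin N) (qTr q X) := by
  ext i j
  simp only [partialQTr_apply, conj_sp2_apply hq, smul_add, smul_smul, Finset.sum_add_distrib,
    ← Finset.sum_smul, sum_DInv_mul_conj_coeff hq, zero_smul, add_zero]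
  rw [Matrix.scalar_apply]
  rcases eq_or_ne i j with rfl | hij
  · simp [qTr_eq_sum]
  · simp [hij]

theorem partialQTr_RA_mul_sp2_mul_RA (hq : q ≠ 0) (X : Matrix (Fin N) (Fin N) A) :
    partialQTr q (RA A q N * sp2 X * RA A q N) =
      Matrix.scalar (Fin N) (qTr q X) + (lam q * q ^ (2 * N)) • X := by
  have hRXR : RA A q N * sp2 X * RA A q N =
      RA A q N * sp2 X * RAInv A q N + lam q • (RA A q N * sp2 X) := by
    nth_rw 2 [RA_eq_RAInv_add A N hq]
    rw [mul_add, mul_smul_comm, mul_one]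
  rw [hRXR, map_add, map_smul, partialQTr_conj hq, partialQTr_mul_sp2, partialQTr_RA hq,
    smul_mul_assoc, one_mul, smul_smul]

theorem partialQTr_inv_conj (hq : q ≠ 0) (X : Matrix (Fin N) (Fin N) A) :
    partialQTr q (RAInv A q N * sp2 X * RA A q N) = Matrix.scalar (Fin N) (qTr q X) := by
  have hrXR : RAInv A q N * sp2 X * RA A q N =
      RA A q N * sp2 X * RA A q N - lam q • (sp2 X * RA A q N) := by
    rw [RAInv_eq_RA_sub A N hq, sub_mul, sub_mul, smul_mul_assoc, smul_mul_assoc, one_mul]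
  rw [hrXR, map_sub, map_smul, partialQTr_RA_mul_sp2_mul_RA hq, partialQTr_sp2_mul,
    partialQTr_RA hq, mul_smul_comm, mul_one, smul_smul, add_sub_cancel_right]

theorem partialQTr_RAInv_mul_sp2_mul_RAInv (hq : q ≠ 0) (X : Matrix (Fin N) (Fin N) A) :
    partialQTr q (RAInv A q N * sp2 X * RAInv A q N) =
      Matrix.scalar (Fin N) (qTr q X) - lam q • X := by
  have hrXr : RAInv A q N * sp2 X * RAInv A q N =
      RA A q N * sp2 X * RAInv A q N - lam q • (sp2 X * RAInv A q N) := by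
    nth_rw 1 [RAInv_eq_RA_sub A N hq]
    rw [sub_mul, sub_mul, smul_mul_assoc, smul_mul_assoc, one_mul]
  rw [hrXr, map_sub, map_smul, partialQTr_conj hq, partialQTr_sp2_mul, partialQTr_RAInv hq,
    mul_one]

end QuantumTrace

section Differential

variable {k : Type*} [Field k] {A : Type*} [Ring A] [Algebra k A] {q : k} {N : ℕ}

theorem commute_scalar_qTr_of_exchange (hq : q ≠ 0) {X Y : Matrix (Fin N) (Fin N) A}
    (hXY : RAInv A q N * sp2 X * RA A q N * sp2 Y = sp2 Y * RA A q N * sp2 X * RAInv A q N) :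
    Commute (Matrix.scalar (Fin N) (qTr q X)) Y := by
  have := congrArg (partialQTr q) hXY
  rwa [mul_assoc (sp2 Y), mul_assoc (sp2 Y), partialQTr_mul_sp2, partialQTr_sp2_mul,
    partialQTr_inv_conj hq, partialQTr_conj hq] at this

theorem commute_scalar_qTr_of_inv_exchange (hq : q ≠ 0) {X Y : Matrix (Fin N) (Fin N) A}
    (hXY : RA A q N * sp2 X * RAInv A q N * sp2 Y = sp2 Y * RAInv A q N * sp2 X * RA A q N) :
    Commute (Matrix.scalar (Fin N) (qTr q X)) Y := by
  have := congrArg (partialQTr q) hXY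
  rwa [mul_assoc (sp2 Y), mul_assoc (sp2 Y), partialQTr_mul_sp2, partialQTr_sp2_mul,
    partialQTr_inv_conj hq, partialQTr_conj hq] at this

theorem commute_scalar_qTr_of_commute (hq : q ≠ 0) {X L : Matrix (Fin N) (Fin N) A}
    (hX : Commute (RA A q N * sp2 L * RA A q N) (sp2 X)) :
    Commute (Matrix.scalar (Fin N) (qTr q X)) L :=
  commute_scalar_qTr_of_exchange hq (exchange_of_commute (R := RAUnit A N hq) hX)

theorem qTr_anticomm {a : A} {X Y : Matrix (Fin N) (Fin N) A}
    (h : Matrix.scalar (Fin N) a * X + X * Matrix.scalar (Fin N) a = Y) :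
    a * qTr q X + qTr q X * a = qTr q Y := by
  rw [← h, qTr_add, qTr_scalar_mul, qTr_mul_scalar]

variable {ω J : Matrix (Fin N) (Fin N) A}

section Traces

variable {L : Matrix (Fin N) (Fin N) A}
  (h : CartanRelations (RA A q N) (RAInv A q N) (sp2 ω) (sp2 J) (sp2 L)) (hq : q ≠ 0)
include h hq

theorem anticomm_scalar_qTr_omega_omega :
    Matrix.scalar (Fin N) (qTr q ω) * ω + ω * Matrix.scalar (Fin N) (qTr q ω) =
      lam q • (ω * ω) := by
  have := congrArg (partialQTr q) h.omega_omega
  rw [mul_assoc, mul_assoc, partialQTr_sp2_mul, ← mul_assoc, map_neg, partialQTr_mul_sp2,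
    partialQTr_inv_conj hq, partialQTr_RAInv_mul_sp2_mul_RAInv hq] at this
  rw [this, sub_mul, smul_mul_assoc]
  abel

theorem anticomm_scalar_qTr_omega_J :
    Matrix.scalar (Fin N) (qTr q ω) * J + J * Matrix.scalar (Fin N) (qTr q ω) = -1 := by
  have := congrArg (partialQTr q) (CartanRelations.inv_conj_omega_J (R := RAUnit A N hq) h)
  change partialQTr q (RAInv A q N * sp2 ω * RA A q N * sp2 J +
    sp2 J * RA A q N * sp2 ω * RAInv A q N) = partialQTr q (-RAInv A q N) at this
  rwa [map_add, map_neg, partialQTr_mul_sp2, mul_assoc (sp2 J), mul_assoc (sp2 J),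
    partialQTr_sp2_mul, partialQTr_inv_conj hq, partialQTr_conj hq, partialQTr_RAInv hq] at this

theorem commute_scalar_qTr_omega_L : Commute (Matrix.scalar (Fin N) (qTr q ω)) L :=
  commute_scalar_qTr_of_commute hq (CartanRelations.commute_omega (R := RAUnit A N hq) h)

theorem commute_scalar_qTr_J_L : Commute (Matrix.scalar (Fin N) (qTr q J)) L :=
  commute_scalar_qTr_of_commute hq (CartanRelations.commute_J (R := RAUnit A N hq) h)

end Traces

section Current

variable {L W : (Matrix (Fin N) (Fin N) A)ˣ}
  (h : CartanRelations (RA A q N) (RAInv A q N) (sp2 ω) (sp2 J) (sp2 L.val)) (hq : q ≠ 0)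
include h hq

theorem sp2_cartanU_omega :
    RA A q N * sp2 (cartanU (lam q) ω J L) * RAInv A q N * sp2 ω =
      sp2 ω * RAInv A q N * sp2 (cartanU (lam q) ω J L) * RA A q N := by
  rw [sp2_cartanU]
  exact CartanRelations.cartanU_omega (R := RAUnit A N hq) (L := sp2Unit k L) h
    (RA_eq_RAInv_add A N hq)

theorem sp2_cartanU_J :
    RAInv A q N * sp2 (cartanU (lam q) ω J L) * RA A q N * sp2 J =
      sp2 J * RA A q N * sp2 (cartanU (lam q) ω J L) * RAInv A q N := by
  rw [sp2_cartanU]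
  exact CartanRelations.cartanU_J (R := RAUnit A N hq) (L := sp2Unit k L) h
    (RA_eq_RAInv_add A N hq)

theorem sp2_cartanU_reflection :
    RAInv A q N * sp2 (cartanU (lam q) ω J L) * RAInv A q N * sp2 (cartanU (lam q) ω J L) =
      sp2 (cartanU (lam q) ω J L) * RAInv A q N * sp2 (cartanU (lam q) ω J L) *
        RAInv A q N := by
  rw [sp2_cartanU]
  exact CartanRelations.cartanU_reflection (R := RAUnit A N hq) (L := sp2Unit k L) h
    (RA_eq_RAInv_add A N hq)

theorem anticomm_scalar_qTr_cartanThetaStar_omega :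
    Matrix.scalar (Fin N) (qTr q (cartanThetaStar (lam q) ω J L)) * ω +
        ω * Matrix.scalar (Fin N) (qTr q (cartanThetaStar (lam q) ω J L)) =
      -(q ^ (2 * N) • cartanU (lam q) ω J L) := by
  set Θ := cartanThetaStar (lam q) ω J L with hΘ
  have hexchange : RA A q N * sp2 Θ * RAInv A q N * sp2 ω +
      sp2 ω * RA A q N * sp2 Θ * RA A q N =
        -(sp2 (L⁻¹.val * cartanWBar (lam q) ω J) * RA A q N) := by
    rw [hΘ, sp2_cartanThetaStar, sp2_mul, sp2_cartanWBar]
    exact CartanRelations.cartanThetaStar_omega (R := RAUnit A N hq) (L := sp2Unit k L) h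
      (RA_eq_RAInv_add A N hq)
  have := congrArg (partialQTr q) hexchange
  rw [map_add, map_neg, partialQTr_mul_sp2, mul_assoc (sp2 ω), mul_assoc (sp2 ω),
    partialQTr_sp2_mul, partialQTr_sp2_mul, partialQTr_conj hq, partialQTr_RA_mul_sp2_mul_RA hq,
    partialQTr_RA hq] at this
  rw [cartanU_eq, eq_sub_of_add_eq this]
  simp only [mul_add, mul_smul_comm, mul_one]
  module

theorem cartanU_apply_eq_anticomm (i j : Fin N) :
    cartanU (lam q) ω J L i j = -((q ^ (2 * N))⁻¹ •
      (qTr q (cartanThetaStar (lam q) ω J L) * ω i j +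
        ω i j * qTr q (cartanThetaStar (lam q) ω J L))) := by
  have := congrFun₂ (anticomm_scalar_qTr_cartanThetaStar_omega h hq) i j
  simp only [Matrix.add_apply, Matrix.neg_apply, Matrix.smul_apply, Matrix.scalar_apply,
    Matrix.diagonal_mul, Matrix.mul_diagonal] at this
  rw [this, smul_neg, neg_neg, inv_smul_smul₀ (pow_ne_zero _ hq)]

variable (hW : W.val = cartanW (lam q) ω J)
include hW

theorem anticomm_scalar_qTr_cartanTheta_J :
    Matrix.scalar (Fin N) (qTr q (cartanTheta ω L W)) * J +
        J * Matrix.scalar (Fin N) (qTr q (cartanTheta ω L W)) = -L.val := by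
  set Θ := cartanTheta ω L W with hΘ
  have hexchange : RAInv A q N * sp2 Θ * RA A q N * sp2 J +
      sp2 J * RA A q N * sp2 Θ * RAInv A q N =
        -(sp2 (L.val * W⁻¹.val) * RAInv A q N * sp2 W.val) := by
    rw [hΘ, sp2_cartanTheta k, sp2_mul]
    exact CartanRelations.cartanTheta_J (R := RAUnit A N hq) (L := sp2Unit k L) h
      (RA_eq_RAInv_add A N hq) (sp2Unit_eq_cartanW hW)
  have := congrArg (partialQTr q) hexchange
  rwa [map_add, map_neg, partialQTr_mul_sp2, mul_assoc (sp2 J), mul_assoc (sp2 J),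
    partialQTr_sp2_mul, partialQTr_mul_sp2, partialQTr_sp2_mul, partialQTr_inv_conj hq,
    partialQTr_conj hq, partialQTr_RAInv hq, mul_one, Units.inv_mul_cancel_right] at this

theorem anticomm_scalar_qTr_cartanTheta_omega :
    Matrix.scalar (Fin N) (qTr q (cartanTheta ω L W)) * ω +
        ω * Matrix.scalar (Fin N) (qTr q (cartanTheta ω L W)) = 0 := by
  set Θ := cartanTheta ω L W with hΘ
  have hexchange : RA A q N * sp2 Θ * RAInv A q N * sp2 ω =
      -(sp2 ω * RAInv A q N * sp2 Θ * RA A q N) := by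
    rw [hΘ, sp2_cartanTheta k]
    exact CartanRelations.cartanTheta_omega (R := RAUnit A N hq) (L := sp2Unit k L) h
      (RA_eq_RAInv_add A N hq) (sp2Unit_eq_cartanW hW)
  have := congrArg (partialQTr q) hexchange
  rw [map_neg, partialQTr_mul_sp2, mul_assoc (sp2 ω), mul_assoc (sp2 ω), partialQTr_sp2_mul,
    partialQTr_inv_conj hq, partialQTr_conj hq] at this
  rw [this, neg_add_cancel]

theorem commute_scalar_qTr_cartanTheta_L :
    Commute (Matrix.scalar (Fin N) (qTr q (cartanTheta ω L W))) L := by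
  apply commute_scalar_qTr_of_commute hq
  rw [sp2_cartanTheta k]
  apply commute_cartanTheta
  · exact CartanRelations.commute_omega (R := RAUnit A N hq) h
  · exact CartanRelations.commute_L (R := RAUnit A N hq) h
  · rw [sp2Unit_eq_cartanW hW]
    exact commute_cartanW (CartanRelations.commute_omega (R := RAUnit A N hq) h)
      (CartanRelations.commute_J (R := RAUnit A N hq) h)

omit hW in
theorem commute_scalar_qTr_cartanThetaStar_L :
    Commute (Matrix.scalar (Fin N) (qTr q (cartanThetaStar (lam q) ω J L))) L := by
  apply commute_scalar_qTr_of_commute hq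
  rw [sp2_cartanThetaStar]
  exact commute_cartanThetaStar (CartanRelations.commute_omega (R := RAUnit A N hq) h)
    (CartanRelations.commute_J (R := RAUnit A N hq) h)
    (CartanRelations.commute_L (R := RAUnit A N hq) h)

omit hW in
theorem commute_scalar_qTr_cartanU_L :
    Commute (Matrix.scalar (Fin N) (qTr q (cartanU (lam q) ω J L))) L := by
  apply commute_scalar_qTr_of_commute hq
  rw [sp2_cartanU]
  exact commute_cartanU (CartanRelations.commute_omega (R := RAUnit A N hq) h)
    (CartanRelations.commute_J (R := RAUnit A N hq) h)
    (CartanRelations.commute_L (R := RAUnit A N hq) h)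

end Current

section Laplacian

/-- The BRST operator `Q`, for matrices over an arbitrary `k`-algebra. The unit `W` stands for
`1 + λ ω J`. -/
def cartanBrst (q : k) (ω J : Matrix (Fin N) (Fin N) A) (L W : (Matrix (Fin N) (Fin N) A)ˣ) :
    A :=
  qTr q ((lam q)⁻¹ • (ω * (L.val - 1)) - ω * L.val * (ω * J) * W⁻¹.val)

/-- The anti-BRST operator `Q*`, for matrices over an arbitrary `k`-algebra. -/
def cartanAntiBrst (q : k) (ω J : Matrix (Fin N) (Fin N) A) (L : (Matrix (Fin N) (Fin N) A)ˣ) :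
    A :=
  qTr q ((lam q)⁻¹ • (J * (L⁻¹.val - 1)) + J * L⁻¹.val * J * ω)

/-- The quantum Laplacian `Δ = Q Q* + Q* Q`, for matrices over an arbitrary `k`-algebra. -/
def cartanLaplacian (q : k) (ω J : Matrix (Fin N) (Fin N) A)
    (L W : (Matrix (Fin N) (Fin N) A)ˣ) : A :=
  cartanBrst q ω J L W * cartanAntiBrst q ω J L + cartanAntiBrst q ω J L * cartanBrst q ω J L W

variable {L W : (Matrix (Fin N) (Fin N) A)ˣ}

theorem cartanAntiBrst_eq (hlam : lam q ≠ 0) :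
    cartanAntiBrst q ω J L =
      (lam q)⁻¹ • (qTr q (cartanThetaStar (lam q) ω J L) - qTr q J) := by
  rw [cartanAntiBrst, ← qTr_sub, ← qTr_smul, cartanThetaStar, cartanWBar]
  congr 1
  simp only [mul_add, mul_sub, mul_one, smul_add, smul_sub, mul_smul_comm,
    inv_smul_smul₀ hlam, mul_assoc]
  abel

theorem cartanBrst_eq (hlam : lam q ≠ 0) (hW : W.val = cartanW (lam q) ω J) :
    cartanBrst q ω J L W = (lam q)⁻¹ • (qTr q (cartanTheta ω L W) - qTr q ω) := by
  have hωL : ω * L.val = cartanTheta ω L W + lam q • (ω * L.val * (ω * J) * W⁻¹.val) :=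
    calc ω * L.val = ω * L.val * (W.val * W⁻¹.val) := by rw [Units.mul_inv, mul_one]
      _ = _ := by
        rw [hW, cartanTheta, cartanW]
        simp only [add_mul, mul_add, one_mul, smul_mul_assoc, mul_smul_comm, mul_assoc]
  rw [cartanBrst, ← qTr_sub, ← qTr_smul, eq_sub_of_add_eq hωL.symm]
  congr 1
  simp only [mul_sub, mul_one, smul_sub, inv_smul_smul₀ hlam]
  abel

variable (h : CartanRelations (RA A q N) (RAInv A q N) (sp2 ω) (sp2 J) (sp2 L.val)) (hq : q ≠ 0)
include h hq

theorem anticomm_qTr_omega_cartanThetaStar :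
    qTr q ω * qTr q (cartanThetaStar (lam q) ω J L) +
        qTr q (cartanThetaStar (lam q) ω J L) * qTr q ω =
      qTr q (lam q • (cartanThetaStar (lam q) ω J L * ω) - L⁻¹.val * cartanWBar (lam q) ω J) := by
  refine qTr_anticomm ((anticomm_cartanThetaStar
    (anticomm_scalar_qTr_omega_J h hq) (anticomm_scalar_qTr_omega_omega h hq)
    (commute_scalar_qTr_omega_L h hq)).trans ?_)
  simp only [cartanThetaStar, cartanWBar, one_mul, mul_add, add_mul, mul_one, mul_smul_comm,
    smul_mul_assoc, mul_assoc]

theorem anticomm_qTr_omega_cartanThetaStar_eq_cartanU :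
    qTr q ω * qTr q (cartanThetaStar (lam q) ω J L) +
        qTr q (cartanThetaStar (lam q) ω J L) * qTr q ω =
      qTr q (-(q ^ (2 * N) • cartanU (lam q) ω J L)) := by
  rw [add_comm]
  exact qTr_anticomm (anticomm_scalar_qTr_cartanThetaStar_omega h hq)

theorem anticomm_qTr_omega_J :
    qTr q ω * qTr q J + qTr q J * qTr q ω = qTr q (-1 : Matrix (Fin N) (Fin N) A) :=
  qTr_anticomm (anticomm_scalar_qTr_omega_J h hq)

variable (hW : W.val = cartanW (lam q) ω J)
include hW

theorem anticomm_qTr_cartanTheta_J :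
    qTr q (cartanTheta ω L W) * qTr q J + qTr q J * qTr q (cartanTheta ω L W) = qTr q (-L.val) :=
  qTr_anticomm (anticomm_scalar_qTr_cartanTheta_J h hq hW)

theorem anticomm_qTr_cartanTheta_cartanThetaStar :
    qTr q (cartanTheta ω L W) * qTr q (cartanThetaStar (lam q) ω J L) +
        qTr q (cartanThetaStar (lam q) ω J L) * qTr q (cartanTheta ω L W) =
      qTr q (-1 : Matrix (Fin N) (Fin N) A) := by
  refine qTr_anticomm ((anticomm_cartanThetaStar
    (anticomm_scalar_qTr_cartanTheta_J h hq hW) (anticomm_scalar_qTr_cartanTheta_omega h hq hW)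
    (commute_scalar_qTr_cartanTheta_L h hq hW)).trans ?_)
  simp only [mul_zero, add_zero, mul_assoc, Units.inv_mul_cancel_left, Units.mul_inv_cancel_left,
    cartanWBar]
  abel

theorem cartanLaplacian_eq_sub (hlam : lam q ≠ 0) :
    cartanLaplacian q ω J L W = (lam q ^ 2)⁻¹ •
      (qTr q (L.val - 2) - (qTr q ω * qTr q (cartanThetaStar (lam q) ω J L) +
        qTr q (cartanThetaStar (lam q) ω J L) * qTr q ω)) := by
  have hone := anticomm_qTr_omega_J h hq
  have hL := anticomm_qTr_cartanTheta_J h hq hW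
  have hstar := anticomm_qTr_cartanTheta_cartanThetaStar h hq hW
  rw [qTr_neg] at hone hL hstar
  have htwo : qTr q (2 : Matrix (Fin N) (Fin N) A) =
      qTr q (1 : Matrix (Fin N) (Fin N) A) + qTr q (1 : Matrix (Fin N) (Fin N) A) := by
    rw [← one_add_one_eq_two, qTr_add]
  rw [cartanLaplacian, cartanBrst_eq hlam hW, cartanAntiBrst_eq hlam, qTr_sub, htwo]
  set t := qTr q (cartanTheta ω L W)
  set s := qTr q (cartanThetaStar (lam q) ω J L)
  set x := qTr q ω
  set y := qTr q J
  rw [smul_mul_smul_comm, smul_mul_smul_comm, ← smul_add, ← mul_inv, ← pow_two]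
  congr 1
  calc (t - x) * (s - y) + (s - y) * (t - x)
      = (t * s + s * t) + (x * y + y * x) - (t * y + y * t) - (x * s + s * x) := by noncomm_ring
    _ = _ := by
      rw [hstar, hone, hL]
      abel

theorem cartanLaplacian_eq_qTr_cartanThetaStar (hlam : lam q ≠ 0) :
    cartanLaplacian q ω J L W = (lam q ^ 2)⁻¹ •
      qTr q (L.val - 2 + L⁻¹.val * cartanWBar (lam q) ω J -
        lam q • (cartanThetaStar (lam q) ω J L * ω)) := by
  rw [cartanLaplacian_eq_sub h hq hW hlam, anticomm_qTr_omega_cartanThetaStar h hq, ← qTr_sub,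
    sub_sub_eq_add_sub]

theorem cartanLaplacian_eq_qTr_cartanU (hlam : lam q ≠ 0) :
    cartanLaplacian q ω J L W = (lam q ^ 2)⁻¹ •
      qTr q (L.val + q ^ (2 * N) • cartanU (lam q) ω J L - 2) := by
  rw [cartanLaplacian_eq_sub h hq hW hlam, anticomm_qTr_omega_cartanThetaStar_eq_cartanU h hq,
    ← qTr_sub, sub_neg_eq_add, sub_add_eq_add_sub]

omit hW

theorem commute_scalar_qTr_cartanU_omega :
    Commute (Matrix.scalar (Fin N) (qTr q (cartanU (lam q) ω J L))) ω :=
  commute_scalar_qTr_of_inv_exchange hq (sp2_cartanU_omega h hq)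

theorem commute_scalar_qTr_cartanU_J :
    Commute (Matrix.scalar (Fin N) (qTr q (cartanU (lam q) ω J L))) J :=
  commute_scalar_qTr_of_exchange hq (sp2_cartanU_J h hq)

theorem commute_qTr_cartanLaplacian (hlam : lam q ≠ 0) (hW : W.val = cartanW (lam q) ω J)
    {X : Matrix (Fin N) (Fin N) A} (hL : Commute (Matrix.scalar (Fin N) (qTr q X)) L.val)
    (hU : Commute (Matrix.scalar (Fin N) (qTr q (cartanU (lam q) ω J L))) X) :
    Commute (qTr q X) (cartanLaplacian q ω J L W) := by
  rw [cartanLaplacian_eq_qTr_cartanU h hq hW hlam, qTr_sub, qTr_add, qTr_smul]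
  have htwo : Commute (qTr q X) (qTr q (2 : Matrix (Fin N) (Fin N) A)) :=
    commute_qTr_of_commute_scalar (Commute.ofNat_right _ 2)
  exact (((commute_qTr_of_commute_scalar hL).add_right
    ((commute_qTr_of_commute_scalar hU).symm.smul_right _)).sub_right htwo).smul_right _

theorem commute_cartanBrst_cartanLaplacian (hlam : lam q ≠ 0)
    (hW : W.val = cartanW (lam q) ω J) :
    Commute (cartanBrst q ω J L W) (cartanLaplacian q ω J L W) := by
  have hUω := commute_scalar_qTr_cartanU_omega h hq
  have hUJ := commute_scalar_qTr_cartanU_J h hq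
  have hUL := commute_scalar_qTr_cartanU_L h hq
  have hUW := hW ▸ commute_cartanW hUω hUJ
  rw [cartanBrst_eq hlam hW]
  refine Commute.smul_left (Commute.sub_left ?_ ?_) _
  · exact commute_qTr_cartanLaplacian h hq hlam hW (commute_scalar_qTr_cartanTheta_L h hq hW)
      (commute_cartanTheta hUω hUL hUW)
  · exact commute_qTr_cartanLaplacian h hq hlam hW (commute_scalar_qTr_omega_L h hq) hUω

theorem commute_cartanAntiBrst_cartanLaplacian (hlam : lam q ≠ 0)
    (hW : W.val = cartanW (lam q) ω J) :
    Commute (cartanAntiBrst q ω J L) (cartanLaplacian q ω J L W) := by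
  have hUω := commute_scalar_qTr_cartanU_omega h hq
  have hUJ := commute_scalar_qTr_cartanU_J h hq
  have hUL := commute_scalar_qTr_cartanU_L h hq
  rw [cartanAntiBrst_eq hlam]
  refine Commute.smul_left (Commute.sub_left ?_ ?_) _
  · exact commute_qTr_cartanLaplacian h hq hlam hW (commute_scalar_qTr_cartanThetaStar_L h hq)
      (commute_cartanThetaStar hUω hUJ hUL)
  · exact commute_qTr_cartanLaplacian h hq hlam hW (commute_scalar_qTr_J_L h hq) hUJ

end Laplacian
end Differential

section Presentation

variable {k : Type*} [Field k] {A B : Type*} [Ring A] [Ring B] [Algebra k A] [Algebra k B]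

theorem mapMatrix_sp2 {N : ℕ} (f : A →ₐ[k] B) (X : Matrix (Fin N) (Fin N) A) :
    f.mapMatrix (sp2 X) = sp2 (X.map f) := by
  ext ⟨a, b⟩ ⟨c, d⟩
  simp [sp2_apply, apply_ite f]

theorem mapMatrix_RA (q : k) (N : ℕ) (f : A →ₐ[k] B) : f.mapMatrix (RA A q N) = RA B q N := by
  ext
  simp [RA]

theorem mapMatrix_RAInv (q : k) (N : ℕ) (f : A →ₐ[k] B) :
    f.mapMatrix (RAInv A q N) = RAInv B q N := by
  ext
  simp [RAInv]

theorem mapMatrix_toDiff_eq {q : k} {N : ℕ} {n : Type*} [Fintype n] [DecidableEq n]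
    {X Y : Matrix n n (FreeAlgebra k (Gen N))} (h : ∀ a b, Rel q N (X a b) (Y a b)) :
    (toDiff q N).mapMatrix X = (toDiff q N).mapMatrix Y := by
  ext a b
  exact RingQuot.mkAlgHom_rel k (h a b)

variable (q : k) (N : ℕ)

theorem diffAlg_cartanRelations :
    CartanRelations (RA (DiffAlg q N) q N) (RAInv (DiffAlg q N) q N) (sp2 (omegaM q N))
      (sp2 (JM q N)) (sp2 (LM q N)) where
  omega_omega := by
    simpa only [map_mul, map_neg, mapMatrix_sp2, mapMatrix_RA, mapMatrix_RAInv, omegaM] using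
      mapMatrix_toDiff_eq (Rel.omega_omega (q := q) (N := N))
  omega_L := by
    simpa only [map_mul, mapMatrix_sp2, mapMatrix_RA, omegaM, LM] using
      mapMatrix_toDiff_eq (Rel.omega_L (q := q) (N := N))
  omega_J := by
    simpa only [map_mul, map_add, map_neg, mapMatrix_sp2, mapMatrix_RA, omegaM, JM] using
      mapMatrix_toDiff_eq (Rel.omega_J (q := q) (N := N))
  L_L := by
    simpa only [map_mul, mapMatrix_sp2, mapMatrix_RA, LM] using
      mapMatrix_toDiff_eq (Rel.L_L (q := q) (N := N))
  J_L := by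
    simpa only [map_mul, mapMatrix_sp2, mapMatrix_RA, JM, LM] using
      mapMatrix_toDiff_eq (Rel.J_L (q := q) (N := N))
  J_J := by
    simpa only [map_mul, map_neg, mapMatrix_sp2, mapMatrix_RA, mapMatrix_RAInv, JM] using
      mapMatrix_toDiff_eq (Rel.J_J (q := q) (N := N))

/-- The matrix `L` over `DiffAlg q N`, as a unit. -/
def LUnit : (Matrix (Fin N) (Fin N) (DiffAlg q N))ˣ where
  val := LM q N
  inv := LInvM q N
  val_inv := by
    have := mapMatrix_toDiff_eq (Rel.L_Linv (q := q) (N := N))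
    simp only [map_mul, map_one] at this
    exact this
  inv_val := by
    have := mapMatrix_toDiff_eq (Rel.Linv_L (q := q) (N := N))
    simp only [map_mul, map_one] at this
    exact this

/-- The matrix `W = 1 + λ ω J` over `DiffAlg q N`, as a unit. -/
def WUnit : (Matrix (Fin N) (Fin N) (DiffAlg q N))ˣ where
  val := WM q N
  inv := WInvM q N
  val_inv := by
    have := mapMatrix_toDiff_eq (Rel.W_Winv (q := q) (N := N))
    simp only [map_mul, map_add, map_smul, map_one] at this
    exact this
  inv_val := by
    have := mapMatrix_toDiff_eq (Rel.Winv_W (q := q) (N := N))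
    simp only [map_mul, map_add, map_smul, map_one] at this
    exact this

end Presentation
end QuantumGL

end

theorem mainTheorem5_general {k A : Type*} [Field k] [Ring A] [Algebra k A] {q : k} {N : ℕ}
    (hq : q ≠ 0) (hq1 : q ^ 2 ≠ 1) {ω J : Matrix (Fin N) (Fin N) A}
    {L W : (Matrix (Fin N) (Fin N) A)ˣ} (hW : W.val = cartanW (lam q) ω J)
    (h : CartanRelations (RA A q N) (RAInv A q N) (sp2 ω) (sp2 J) (sp2 L.val)) :
    cartanLaplacian q ω J L W = (lam q ^ 2)⁻¹ •
        qTr q (L.val - 2 + L⁻¹.val * cartanWBar (lam q) ω J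
          - lam q • (cartanThetaStar (lam q) ω J L * ω)) ∧
    cartanLaplacian q ω J L W = (lam q ^ 2)⁻¹ •
        qTr q (L.val + q ^ (2 * N) • cartanU (lam q) ω J L - 2) ∧
    cartanBrst q ω J L W * cartanLaplacian q ω J L W
      - cartanLaplacian q ω J L W * cartanBrst q ω J L W = 0 ∧
    cartanAntiBrst q ω J L * cartanLaplacian q ω J L W
      - cartanLaplacian q ω J L W * cartanAntiBrst q ω J L = 0 ∧
    (∀ i j : Fin N, cartanU (lam q) ω J L i j = -((q ^ (2 * N))⁻¹ •
        (qTr q (cartanThetaStar (lam q) ω J L) * ω i j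
          + ω i j * qTr q (cartanThetaStar (lam q) ω J L)))) ∧
    RAInv A q N * sp2 (cartanU (lam q) ω J L) * RAInv A q N * sp2 (cartanU (lam q) ω J L)
      = sp2 (cartanU (lam q) ω J L) * RAInv A q N * sp2 (cartanU (lam q) ω J L)
        * RAInv A q N ∧
    RA A q N * sp2 (cartanU (lam q) ω J L) * RAInv A q N * sp2 ω
      = sp2 ω * RAInv A q N * sp2 (cartanU (lam q) ω J L) * RA A q N ∧
    RAInv A q N * sp2 (cartanU (lam q) ω J L) * RA A q N * sp2 J
      = sp2 J * RA A q N * sp2 (cartanU (lam q) ω J L) * RAInv A q N :=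
  have hlam := lam_ne_zero hq hq1
  ⟨cartanLaplacian_eq_qTr_cartanThetaStar h hq hW hlam,
    cartanLaplacian_eq_qTr_cartanU h hq hW hlam,
    sub_eq_zero.mpr (commute_cartanBrst_cartanLaplacian h hq hlam hW).eq,
    sub_eq_zero.mpr (commute_cartanAntiBrst_cartanLaplacian h hq hlam hW).eq,
    cartanU_apply_eq_anticomm h hq,
    sp2_cartanU_reflection h hq, sp2_cartanU_omega h hq, sp2_cartanU_J h hq⟩

theorem mainTheorem5 {k : Type*} [Field k] (q : k) (N : ℕ)
    (hq : q ≠ 0) (hq1 : q ^ 2 ≠ 1) (hq2 : q ^ 2 ≠ -1) :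
    -- the two expressions for the Laplacian
    laplacian q N = (lam q ^ 2)⁻¹ •
        qTr q (LM q N - 2 + LInvM q N * WBarM q N
          - lam q • (JM q N * LInvM q N * WBarM q N * omegaM q N)) ∧
    laplacian q N = (lam q ^ 2)⁻¹ •
        qTr q (LM q N + q ^ (2 * N) • UM q N - 2) ∧
    -- the Laplacian is BRST and anti-BRST invariant
    brst q N * laplacian q N - laplacian q N * brst q N = 0 ∧
    antiBrst q N * laplacian q N - laplacian q N * antiBrst q N = 0 ∧
    -- `U = - q^{-2N} [Tr_q(Θ*), ω]_+`
    (∀ i j : Fin N, UM q N i j = -((q ^ (2 * N))⁻¹ •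
        (qTr q (ThetaStarM q N) * omegaM q N i j
          + omegaM q N i j * qTr q (ThetaStarM q N)))) ∧
    -- the reflection equation for `U`
    RAInv (DiffAlg q N) q N * sp2 (UM q N) * RAInv (DiffAlg q N) q N * sp2 (UM q N)
      = sp2 (UM q N) * RAInv (DiffAlg q N) q N * sp2 (UM q N) * RAInv (DiffAlg q N) q N ∧
    -- the commutation relations of `U` with `ω` and `J`
    RA (DiffAlg q N) q N * sp2 (UM q N) * RAInv (DiffAlg q N) q N * sp2 (omegaM q N)
      = sp2 (omegaM q N) * RAInv (DiffAlg q N) q N * sp2 (UM q N) * RA (DiffAlg q N) q N ∧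
    RAInv (DiffAlg q N) q N * sp2 (UM q N) * RA (DiffAlg q N) q N * sp2 (JM q N)
      = sp2 (JM q N) * RA (DiffAlg q N) q N * sp2 (UM q N) * RAInv (DiffAlg q N) q N :=
  mainTheorem5_general (L := LUnit q N) (W := WUnit q N) hq hq1 rfl
    (diffAlg_cartanRelations q N)
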